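/- Let $\{Y_n\}_{n\ge1}$ be a standard stationary Gaussian sequence, i.e. a strictly stationary, jointly Gaussian sequence of random variables with mean $0$ and variance $1$, whose covariance function $r_n=\mathrm{Cov}(Y_1,Y_{n+1})$ satisfies $r_n\log n\to0$ as $n\to\infty$. Let $\{\widehat Y_n\}_{n\ge1}$ be an independent copy of $\{Y_n\}$, and let $\varepsilon=\{\varepsilon_n\}_{n\ge1}$ be a sequence of $\{0,1\}$-valued random variables (with arbitrary joint law) that is independent of the pair of sequences $(\{Y_n\},\{\widehat Y_n\})$ and for which $$\frac1n\sum_{k=1}^n\varepsilon_k\to\lambda\quad\text{in probability}$$ for some random variable $\lambda$ with $\lambda\in[0,1]$ almost surely. Define the replaced sequence $Y_n(\varepsilon)=\varepsilon_nY_n+(1-\varepsilon_n)\widehat Y_n$ and put $M_n(Y)=\max_{1\le k\le n}Y_k$, $M_n(Y(\varepsilon))=\max_{1\le k\le n}Y_k(\varepsilon)$. Then for all $x,y\in\mathbb R$, $$\lim_{n\to\infty}P\left(M_n(Y(\varepsilon))\le a_n^{-1}x+b_n,\ M_n(Y)\le a_n^{-1}y+b_n\right)=\exp\left(-e^{-\min\{x,y\}}\right)\,E\exp\left(-(1-\lambda)e^{-\max\{x,y\}}\right),$$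 where $a_n=(2\log n)^{1/2}$ and $b_n=a_n-\dfrac{\log\log n+\log(4\pi)}{2a_n}$. -/

import Mathlib

open MeasureTheory ProbabilityTheory Filter Topology

noncomputable section

/-- A sequence of random variables is strictly stationary: for every shift `k`, the shifted
sequence `(X_{k}, X_{k+1}, …)` has the same law (on the sequence space) as `(X_0, X_1, …)`. -/
def StrictlyStationary {Ω : Type*} [MeasurableSpace Ω] (P : Measure Ω) (X : ℕ → Ω → ℝ) : Prop :=
  ∀ k : ℕ, IdentDistrib (fun ω (n : ℕ) => X (n + k) ω) (fun ω (n : ℕ) => X n ω) P P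

/-- A standard stationary Gaussian sequence: all finite-dimensional distributions are Gaussian,
the sequence is strictly stationary, and every term has mean `0` and variance `1`. -/
structure IsStandardStationaryGaussian {Ω : Type*} [MeasurableSpace Ω] (P : Measure Ω)
    (Y : ℕ → Ω → ℝ) : Prop where
  gaussian : IsGaussianProcess Y P
  stationary : StrictlyStationary P Y
  mean_zero : ∀ n, ∫ ω, Y n ω ∂P = 0
  variance_one : ∀ n, Var[Y n; P] = 1

/-- `X'` is an independent copy of the sequence `X`: it has the same law on the sequence space
and the two sequences are independent. -/
structure IsIndependentCopy {Ω : Type*} [MeasurableSpace Ω] (P : Measure Ω)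
    (X X' : ℕ → Ω → ℝ) : Prop where
  identDistrib : IdentDistrib (fun ω (n : ℕ) => X' n ω) (fun ω (n : ℕ) => X n ω) P P
  indep : IndepFun (fun ω (n : ℕ) => X n ω) (fun ω (n : ℕ) => X' n ω) P

/-- The random replacing sequence `X_n(ε) = ε_n X_n + (1 - ε_n) X'_n`. -/
def randomReplacing {Ω : Type*} (ε X X' : ℕ → Ω → ℝ) (n : ℕ) (ω : Ω) : ℝ :=
  ε n ω * X n ω + (1 - ε n ω) * X' n ω

/-- The maximum `M_n(X)` of the first `n` terms of the sequence `X` (meaningful for `n ≥ 1`;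
sequences are indexed from `0`, so the first `n` terms are `X 0, …, X (n - 1)`). -/
def partialMax {Ω : Type*} (X : ℕ → Ω → ℝ) (n : ℕ) (ω : Ω) : ℝ :=
  ⨆ k : Fin n, X k ω

/-- The number `S_n` of observed variables among the first `n`. -/
def observedCount {Ω : Type*} (ε : ℕ → Ω → ℝ) (n : ℕ) (ω : Ω) : ℝ :=
  ∑ k ∈ Finset.range n, ε k ω

/-- `a_n = (2 log n)^{1/2}`. -/
def gumbelA (n : ℕ) : ℝ := √(2 * Real.log n)

/-- `b_n = a_n - (log log n + log 4π) / (2 a_n)`. -/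
def gumbelB (n : ℕ) : ℝ :=
  gumbelA n - (Real.log (Real.log n) + Real.log (4 * Real.pi)) / (2 * gumbelA n)

end

/-! Write u_n(x) = x/a_n + b_n, let Φ be the standard normal distribution function, and S_n = ε_1 +
… + ε_n. Since ε is independent of the two Gaussian sequences, the probability is an average over
deterministic patterns e (`IndepFun.abs_measureReal_sub_integral_le`). For fixed e the event asks
Y_k ≤ u_n(min{x,y}) where e_k = 1, and Y_k ≤ u_n(y), Ŷ_k ≤ u_n(x) where e_k = 0. If all the
variables were independent, its probability would be Φ(u_n(min{x,y}))^n Φ(u_n(max{x,y}))^(n - S_n),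
because each index with e_k = 0 contributes Φ(u_n(x))Φ(u_n(y)) (`abs_measureReal_replaced_sub_le`).
Mills' ratio gives Φ(u_n(x))^n → exp(-e^{-x}); as S_n/n → λ in probability, bounded convergence then
yields the limit.

The actual dependence must be shown negligible uniformly in e. Berman's comparison inequality
(`abs_measureReal_sub_prod_le`) bounds the error of replacing a Gaussian vector by independent
coordinates by a sum over pairs of |r| exp(-u²/(1+|r|)), up to a constant. Summing over all pairs of
indices below n gives a bound that does not see e, and r_n log n → 0 makes it vanish
(`tendsto_nat_mul_sum_berman`).

For the comparison inequality, indicators are smoothed and the vector X is rotated into an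
independent vector Z with independent coordinates. In the derivative with respect to the angle,
Gaussian integration by parts leaves only off-diagonal terms, since both vectors have unit
variances. Each is at most a covariance times E|φ_i' φ_j'|, and the latter is controlled by the
bivariate density on [u,∞)² whatever the width of the smoothing. -/

/-! ### Gaussian integration by parts and a bivariate density bound. -/

/-- Stein's identity for the standard normal law. -/
theorem integral_mul_gaussianReal_eq_integral_deriv {g g' : ℝ → ℝ} {C C' : ℝ}
    (hg : ∀ x, HasDerivAt g (g' x) x) (hg'm : Measurable g')
    (hC : ∀ x, |g x| ≤ C) (hC' : ∀ x, |g' x| ≤ C') :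
    ∫ x, x * g x ∂gaussianReal 0 1 = ∫ x, g' x ∂gaussianReal 0 1 := by
  have hgm : Measurable g :=
    (continuous_iff_continuousAt.2 fun x => (hg x).continuousAt).measurable
  have hpdf : ∀ x, HasDerivAt (gaussianPDFReal 0 1) (-x * gaussianPDFReal 0 1 x) x := by
    intro x
    have h1 : HasDerivAt (fun x : ℝ => -(x - 0) ^ 2 / (2 * ((1 : NNReal) : ℝ))) (-x) x := by
      have := (((hasDerivAt_id x).sub_const (0 : ℝ)).pow 2).neg.div_const (2 * ((1 : NNReal) : ℝ))
      refine this.congr_deriv ?_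
      simp
      ring
    have h2 := (h1.exp).const_mul ((√(2 * Real.pi * ((1 : NNReal) : ℝ)))⁻¹)
    refine h2.congr_deriv ?_
    simp only [gaussianPDFReal]
    ring
  have hint1 : Integrable (fun x => g' x * gaussianPDFReal 0 1 x) :=
    (integrable_gaussianPDFReal 0 1).bdd_mul hg'm.aestronglyMeasurable
      (Eventually.of_forall hC')
  have hint0 : Integrable (fun x => g x * gaussianPDFReal 0 1 x) :=
    (integrable_gaussianPDFReal 0 1).bdd_mul hgm.aestronglyMeasurable
      (Eventually.of_forall hC)
  have hid : Integrable (fun x => x * gaussianPDFReal 0 1 x) := by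
    have h : Integrable (fun x : ℝ => x) (gaussianReal 0 1) :=
      (memLp_id_gaussianReal (μ := 0) (v := 1) 1).integrable le_rfl
    rw [gaussianReal_of_var_ne_zero 0 one_ne_zero,
      integrable_withDensity_iff (measurable_gaussianPDF 0 1)
        (Eventually.of_forall fun _ => gaussianPDF_lt_top)] at h
    simpa using h
  have hint2 : Integrable (fun x => g x * (-x * gaussianPDFReal 0 1 x)) := by
    have := (hid.neg).bdd_mul hgm.aestronglyMeasurable (Eventually.of_forall hC)
    refine this.congr (Eventually.of_forall fun x => ?_)
    simp
  -- The derivative of g times the density is (g' - x g) times the density, and it integrates to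
  -- zero over the line.
  have key := integral_eq_zero_of_hasDerivAt_of_integrable
    (f := fun x => g x * gaussianPDFReal 0 1 x)
    (fun x => (hg x).mul (hpdf x)) (hint1.add hint2) hint0
  rw [integral_add hint1 hint2] at key
  rw [integral_gaussianReal_eq_integral_smul one_ne_zero,
    integral_gaussianReal_eq_integral_smul one_ne_zero]
  simp only [smul_eq_mul]
  have e1 : ∫ x, gaussianPDFReal 0 1 x * g' x = ∫ x, g' x * gaussianPDFReal 0 1 x := by
    congr 1; ext x; ring
  have e2 : ∫ x, gaussianPDFReal 0 1 x * (x * g x) =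
      -∫ x, g x * (-x * gaussianPDFReal 0 1 x) := by
    rw [← integral_neg]; congr 1; ext x; ring
  rw [e1, e2]
  linarith

/-- Bound for the density of the bivariate normal law in the quadrant `[u, ∞)²`. -/
theorem gaussianPDFReal_mul_gaussianPDFReal_le {ρ r δ u s t : ℝ} (hρ : |ρ| ≤ r) (hr : r ≤ δ)
    (hδ : δ < 1) (hu : 0 ≤ u) (hs : u ≤ s) (ht : u ≤ t) :
    gaussianPDFReal 0 1 s * gaussianPDFReal 0 (Real.toNNReal (1 - ρ ^ 2)) (t - ρ * s) ≤
      (2 * Real.pi * √(1 - δ ^ 2))⁻¹ * Real.exp (-u ^ 2 / (1 + r)) := by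
  have hr0 : 0 ≤ r := (abs_nonneg _).trans hρ
  have hρ2 : ρ ^ 2 ≤ δ ^ 2 := by
    rw [← sq_abs ρ]; exact pow_le_pow_left₀ (abs_nonneg _) (hρ.trans hr) 2
  have hδ2 : δ ^ 2 < 1 := by nlinarith
  have h1 : 0 < 1 - ρ ^ 2 := by linarith
  have hcoe : ((Real.toNNReal (1 - ρ ^ 2) : NNReal) : ℝ) = 1 - ρ ^ 2 := Real.coe_toNNReal _ h1.le
  simp only [gaussianPDFReal, hcoe, sub_zero, NNReal.coe_one, mul_one]
  have e : (√(2 * Real.pi))⁻¹ * Real.exp (-s ^ 2 / 2) *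
      ((√(2 * Real.pi * (1 - ρ ^ 2)))⁻¹ *
        Real.exp (-(t - ρ * s) ^ 2 / (2 * (1 - ρ ^ 2)))) =
      (2 * Real.pi * √(1 - ρ ^ 2))⁻¹ *
        Real.exp (-s ^ 2 / 2 + -(t - ρ * s) ^ 2 / (2 * (1 - ρ ^ 2))) := by
    rw [Real.exp_add, Real.sqrt_mul (by positivity : (0 : ℝ) ≤ 2 * Real.pi) (1 - ρ ^ 2)]
    have : √(2 * Real.pi) * √(2 * Real.pi) = 2 * Real.pi := Real.mul_self_sqrt (by positivity)
    have h2 : (2 * Real.pi * √(1 - ρ ^ 2))⁻¹ =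
        (√(2 * Real.pi))⁻¹ * (√(2 * Real.pi))⁻¹ * (√(1 - ρ ^ 2))⁻¹ := by
      rw [← mul_inv, this, mul_inv]
    rw [h2, mul_inv]
    ring
  rw [e]
  have hsq : 0 < √(1 - δ ^ 2) := Real.sqrt_pos.2 (by linarith)
  gcongr
  have e2 : -s ^ 2 / 2 + -(t - ρ * s) ^ 2 / (2 * (1 - ρ ^ 2)) =
      -((s ^ 2 - 2 * ρ * s * t + t ^ 2) / (2 * (1 - ρ ^ 2))) := by
    field_simp
    ring
  rw [e2, neg_div]
  apply neg_le_neg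
  have hfac : 1 - ρ ^ 2 = (1 - |ρ|) * (1 + |ρ|) := by rw [← sq_abs ρ]; ring
  have ha1 : 0 < 1 - |ρ| := by linarith
  have hs0 := hu.trans hs
  have ht0 := hu.trans ht
  have hst : ρ * s * t ≤ |ρ| * (s * t) := by
    rw [mul_assoc]; exact mul_le_mul_of_nonneg_right (le_abs_self ρ) (mul_nonneg hs0 ht0)
  -- From s² - 2|ρ|st + t² = (1 - |ρ|)(s² + t²) + |ρ|(s - t)²; the factor 1 - |ρ| then cancels
  -- against 1 - ρ², leaving 1 + |ρ|.
  have hquad : 2 * (1 - |ρ|) * u ^ 2 ≤ s ^ 2 - 2 * ρ * s * t + t ^ 2 := by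
    have hs2 : u ^ 2 ≤ s ^ 2 := pow_le_pow_left₀ hu hs 2
    have ht2 : u ^ 2 ≤ t ^ 2 := pow_le_pow_left₀ hu ht 2
    nlinarith [mul_nonneg (abs_nonneg ρ) (sq_nonneg (s - t)),
      mul_le_mul_of_nonneg_left hs2 ha1.le, mul_le_mul_of_nonneg_left ht2 ha1.le]
  calc u ^ 2 / (1 + r) ≤ u ^ 2 / (1 + |ρ|) := by gcongr
    _ = (2 * (1 - |ρ|) * u ^ 2) / (2 * (1 - ρ ^ 2)) := by
        rw [hfac]; field_simp
    _ ≤ _ := by gcongr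

/-- Nonnegative functions supported in `[u, ∞)` of a bivariate standard normal vector. -/
theorem lintegral_mul_le_of_hasGaussianLaw {Ω : Type*} [MeasurableSpace Ω] {P : Measure Ω}
    {U V : Ω → ℝ} (hUV : HasGaussianLaw (fun ω => (U ω, V ω)) P)
    (hU0 : ∫ ω, U ω ∂P = 0) (hV0 : ∫ ω, V ω ∂P = 0) (hU1 : Var[U; P] = 1) (hV1 : Var[V; P] = 1)
    {r δ u : ℝ} (hρ : |cov[U, V; P]| ≤ r) (hr : r ≤ δ) (hδ : δ < 1) (hu : 0 ≤ u)
    {f g : ℝ → ENNReal} (hf : Measurable f) (hg : Measurable g)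
    (hfu : ∀ x < u, f x = 0) (hgu : ∀ x < u, g x = 0)
    (hf1 : ∫⁻ x, f x ≤ 1) (hg1 : ∫⁻ x, g x ≤ 1) :
    ∫⁻ ω, f (U ω) * g (V ω) ∂P ≤
      ENNReal.ofReal ((2 * Real.pi * √(1 - δ ^ 2))⁻¹ * Real.exp (-u ^ 2 / (1 + r))) := by
  have hprob := hUV.isProbabilityMeasure
  set ρ := cov[U, V; P] with hρdef
  have hUm : AEMeasurable U P := hUV.fst.aemeasurable
  have hVm : AEMeasurable V P := hUV.snd.aemeasurable
  have hU2 : MemLp U 2 P := hUV.fst.memLp_two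
  have hV2 : MemLp V 2 P := hUV.snd.memLp_two
  have hUi := hUV.fst.integrable
  have hVi := hUV.snd.integrable
  let R : Ω → ℝ := fun ω => V ω - ρ * U ω
  have hUR : HasGaussianLaw (fun ω => (U ω, R ω)) P := by
    let A : ℝ × ℝ →L[ℝ] ℝ × ℝ := (ContinuousLinearMap.fst ℝ ℝ ℝ).prod
      (ContinuousLinearMap.snd ℝ ℝ ℝ - ρ • ContinuousLinearMap.fst ℝ ℝ ℝ)
    have h : (fun ω => (U ω, R ω)) = A ∘ fun ω => (U ω, V ω) := by
      ext ω <;> simp [A, R]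
    rw [h]
    exact hUV.map A
  have hρU : MemLp (fun ω => ρ * U ω) 2 P := hU2.const_mul ρ
  have hcov : cov[U, R; P] = 0 := by
    rw [covariance_fun_sub_right hU2 hV2 hρU, covariance_const_mul_right,
      covariance_self hUm, hU1, ← hρdef]; ring
  have hind : IndepFun U R P := hUR.indepFun_of_covariance_eq_zero hcov
  have hRvar : Var[R; P] = 1 - ρ ^ 2 := by
    rw [variance_fun_sub hV2 hρU, covariance_const_mul_right, variance_const_mul, hU1, hV1,
      covariance_comm V U, ← hρdef]
    ring
  have hRmean : ∫ ω, R ω ∂P = 0 := by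
    rw [integral_sub hVi (hUi.const_mul ρ), integral_const_mul, hU0, hV0]; simp
  have hRm : AEMeasurable R P := hUR.snd.aemeasurable
  have lawU : P.map U = gaussianReal 0 1 := by
    rw [hUV.fst.map_eq_gaussianReal, hU0, hU1]; simp
  have lawR : P.map R = gaussianReal 0 (Real.toNNReal (1 - ρ ^ 2)) := by
    rw [hUR.snd.map_eq_gaussianReal, hRmean, hRvar]
  have hr0 : 0 ≤ r := (abs_nonneg _).trans hρ
  have hv : 0 < 1 - ρ ^ 2 := by
    have : ρ ^ 2 < 1 := by
      rw [← sq_abs ρ]; nlinarith [abs_nonneg ρ]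
    linarith
  have hvne : Real.toNNReal (1 - ρ ^ 2) ≠ 0 := by simpa using hv
  have hmap := (indepFun_iff_map_prod_eq_prod_map_map hUm hRm).1 hind
  set v := Real.toNNReal (1 - ρ ^ 2) with hvdef
  set K := (2 * Real.pi * √(1 - δ ^ 2))⁻¹ * Real.exp (-u ^ 2 / (1 + r)) with hK
  have e1 : ∫⁻ ω, f (U ω) * g (V ω) ∂P =
      ∫⁻ p, f p.1 * g (ρ * p.1 + p.2) ∂(P.map fun ω => (U ω, R ω)) := by
    rw [lintegral_map' (by fun_prop) (hUm.prodMk hRm)]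
    simp [R]
  rw [e1, hmap, lawU, lawR, lintegral_prod _ (by fun_prop)]
  rw [gaussianReal_of_var_ne_zero 0 one_ne_zero, gaussianReal_of_var_ne_zero 0 hvne]
  rw [lintegral_withDensity_eq_lintegral_mul _ (measurable_gaussianPDF 0 1)
    (Measurable.lintegral_prod_right' (f := fun p : ℝ × ℝ => f p.1 * g (ρ * p.1 + p.2))
      (by fun_prop))]
  simp only [Pi.mul_apply]
  have inner : ∀ s, gaussianPDF 0 1 s * ∫⁻ z, f s * g (ρ * s + z)
        ∂(volume.withDensity (gaussianPDF 0 v)) ≤ f s * ENNReal.ofReal K := by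
    intro s
    rcases lt_or_ge s u with hs | hs
    · simp [hfu s hs]
    rw [lintegral_withDensity_eq_lintegral_mul _ (measurable_gaussianPDF 0 v) (by fun_prop),
      ← lintegral_const_mul _ (by fun_prop)]
    have tr := lintegral_sub_right_eq_self (μ := volume)
      (fun z => gaussianPDF 0 1 s * (gaussianPDF 0 v * fun z => f s * g (ρ * s + z)) z) (ρ * s)
    rw [← tr]
    calc _ ≤ ∫⁻ t, f s * ENNReal.ofReal K * g t := by
          refine lintegral_mono fun t => ?_
          simp only [Pi.mul_apply, add_sub_cancel]
          rcases lt_or_ge t u with ht | ht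
          · simp [hgu t ht]
          have := ENNReal.ofReal_le_ofReal
            (gaussianPDFReal_mul_gaussianPDFReal_le hρ hr hδ hu hs ht)
          rw [ENNReal.ofReal_mul (gaussianPDFReal_nonneg _ _ _)] at this
          calc _ = f s * g t * (gaussianPDF 0 1 s * gaussianPDF 0 v (t - ρ * s)) := by ring
            _ ≤ f s * g t * ENNReal.ofReal K := by gcongr; exact this
            _ = _ := by ring
      _ ≤ f s * ENNReal.ofReal K * 1 := by
          rw [lintegral_const_mul _ hg]; gcongr
      _ = _ := mul_one _
  calc _ ≤ ∫⁻ s, f s * ENNReal.ofReal K := lintegral_mono inner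
    _ = (∫⁻ s, f s) * ENNReal.ofReal K := lintegral_mul_const _ hf
    _ ≤ 1 * ENNReal.ofReal K := by gcongr
    _ = _ := one_mul _

theorem abs_prod_le_of_abs_le {ι : Type*} {s : Finset ι} {a : ι → ℝ} {C : ℝ}
    (h : ∀ i, |a i| ≤ C) : |∏ i ∈ s, a i| ≤ C ^ s.card := by
  rw [Finset.abs_prod]
  exact (Finset.prod_le_prod (fun i _ => abs_nonneg _) fun i _ => h i).trans (by simp)

theorem abs_prod_le_one {ι : Type*} (s : Finset ι) {a : ι → ℝ} (h : ∀ i, |a i| ≤ 1) :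
    |∏ i ∈ s, a i| ≤ 1 :=
  (abs_prod_le_of_abs_le h).trans (one_pow _).le

/-- Gaussian integration by parts for a product of functions of one coordinate each. -/
theorem integral_mul_prod_of_hasGaussianLaw {ι Ω : Type*} [Fintype ι] [DecidableEq ι]
    [MeasurableSpace Ω] {P : Measure Ω} {V : Ω → ℝ} {W : ι → Ω → ℝ}
    (hVm : Measurable V) (hWm : ∀ i, Measurable (W i))
    (hVW : HasGaussianLaw (fun ω => (V ω, fun i => W i ω)) P)
    (hV0 : ∫ ω, V ω ∂P = 0) (hV1 : Var[V; P] = 1)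
    {G G' : ι → ℝ → ℝ} {C : ℝ} (hG : ∀ i x, HasDerivAt (G i) (G' i x) x)
    (hG'm : ∀ i, Measurable (G' i)) (hC : ∀ i x, |G i x| ≤ C) (hC' : ∀ i x, |G' i x| ≤ C) :
    ∫ ω, V ω * ∏ i, G i (W i ω) ∂P =
      ∑ k, cov[V, W k; P] *
        ∫ ω, G' k (W k ω) * ∏ l ∈ Finset.univ.erase k, G l (W l ω) ∂P := by
  have hprob := hVW.isProbabilityMeasure
  have hGm : ∀ i, Measurable (G i) := fun i =>
    (continuous_iff_continuousAt.2 fun x => (hG i x).continuousAt).measurable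
  set c : ι → ℝ := fun k => cov[V, W k; P] with hc
  -- Residuals independent of V: with them frozen, the product is a function of V alone, Stein's
  -- identity applies, and the chain rule brings out the covariances c k.
  let R : ι → Ω → ℝ := fun k ω => W k ω - c k * V ω
  have hRm : ∀ k, Measurable (R k) := fun k => (hWm k).sub (hVm.const_mul _)
  have hV2 : MemLp V 2 P := hVW.fst.memLp_two
  have hW2 : ∀ k, MemLp (W k) 2 P := fun k => (hVW.snd.eval k).memLp_two
  have hVR : HasGaussianLaw (fun ω => (fun _ : Unit => V ω, fun i => R i ω)) P := by
    let A : ℝ × (ι → ℝ) →L[ℝ] (Unit → ℝ) × (ι → ℝ) :=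
      (ContinuousLinearMap.pi fun _ => ContinuousLinearMap.fst ℝ ℝ (ι → ℝ)).prod
        (ContinuousLinearMap.pi fun k =>
          (ContinuousLinearMap.proj k).comp (ContinuousLinearMap.snd ℝ ℝ (ι → ℝ)) -
            c k • ContinuousLinearMap.fst ℝ ℝ (ι → ℝ))
    have h : (fun ω => ((fun _ : Unit => V ω), fun i => R i ω)) =
        A ∘ fun ω => (V ω, fun i => W i ω) := by
      ext ω <;> simp [A, R]
    rw [h]
    exact hVW.map A
  have hind : IndepFun V (fun ω i => R i ω) P := by
    have := HasGaussianLaw.indepFun_of_covariance_eval (X := fun _ : Unit => V) (Y := R) hVR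
      (fun _ k => by
        rw [covariance_fun_sub_right hV2 (hW2 k) (hV2.const_mul _), covariance_const_mul_right,
          covariance_self hVm.aemeasurable, hV1]
        simp [hc])
    exact this.comp (φ := fun f : Unit → ℝ => f ()) (ψ := id) (by fun_prop) measurable_id
  have lawV : P.map V = gaussianReal 0 1 := by
    rw [hVW.fst.map_eq_gaussianReal, hV0, hV1]; simp
  have hRm' : Measurable fun ω i => R i ω := measurable_pi_lambda _ hRm
  set μR := P.map (fun ω i => R i ω) with hμR
  have hμRp : IsProbabilityMeasure μR := Measure.isProbabilityMeasure_map hRm'.aemeasurable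
  have hmap : P.map (fun ω => (V ω, fun i => R i ω)) = (gaussianReal 0 1).prod μR := by
    rw [(indepFun_iff_map_prod_eq_prod_map_map hVm.aemeasurable hRm'.aemeasurable).1 hind, lawV]
  have hVRm : Measurable fun ω => (V ω, fun i => R i ω) := hVm.prodMk hRm'
  let F : ℝ × (ι → ℝ) → ℝ := fun p => p.1 * ∏ i, G i (p.2 i + c i * p.1)
  let H : ι → ℝ × (ι → ℝ) → ℝ := fun k p =>
    G' k (p.2 k + c k * p.1) * ∏ l ∈ Finset.univ.erase k, G l (p.2 l + c l * p.1)
  have hFm : Measurable F := by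
    refine measurable_fst.mul (Finset.measurable_fun_prod _ fun i _ => (hGm i).comp ?_)
    fun_prop
  have hHm : ∀ k, Measurable (H k) := by
    intro k
    refine ((hG'm k).comp (by fun_prop)).mul
      (Finset.measurable_fun_prod _ fun i _ => (hGm i).comp ?_)
    fun_prop
  have hFV : ∀ ω, F (V ω, fun i => R i ω) = V ω * ∏ i, G i (W i ω) := fun ω => by
    simp [F, R]
  have hHV : ∀ k ω, H k (V ω, fun i => R i ω) =
      G' k (W k ω) * ∏ l ∈ Finset.univ.erase k, G l (W l ω) := fun k ω => by
    simp [H, R]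
  have hHb : ∀ k p, ‖H k p‖ ≤ C * C ^ (Finset.univ.erase k).card := by
    intro k p
    rw [Real.norm_eq_abs, abs_mul]
    exact mul_le_mul (hC' _ _) (abs_prod_le_of_abs_le fun i => hC _ _) (abs_nonneg _)
      ((abs_nonneg _).trans (hC' k 0))
  have hHi : ∀ k, Integrable (H k) ((gaussianReal 0 1).prod μR) := fun k =>
    Integrable.of_bound (hHm k).aestronglyMeasurable _ (Eventually.of_forall (hHb k))
  have hFi : Integrable F ((gaussianReal 0 1).prod μR) := by
    rw [← hmap, integrable_map_measure hFm.aestronglyMeasurable hVRm.aemeasurable]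
    have h0 : Integrable (fun ω => (∏ i, G i (W i ω)) * V ω) P := by
      refine (hV2.integrable (by norm_num)).bdd_mul
        (c := C ^ (Finset.univ : Finset ι).card) ?_ ?_
      · exact (Finset.measurable_fun_prod _ fun i _ =>
          (hGm i).comp (hWm i)).aestronglyMeasurable
      · exact Eventually.of_forall fun ω => abs_prod_le_of_abs_le fun i => hC _ _
    refine h0.congr (Eventually.of_forall fun ω => ?_)
    simp only [Function.comp_apply, hFV, mul_comm]
  have hinner : ∀ r : ι → ℝ, ∫ v, F (v, r) ∂gaussianReal 0 1 =
      ∫ v, ∑ k, c k * H k (v, r) ∂gaussianReal 0 1 := by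
    intro r
    refine integral_mul_gaussianReal_eq_integral_deriv
      (g := fun v => ∏ i, G i (r i + c i * v)) (C := C ^ (Finset.univ : Finset ι).card)
      (C' := ∑ k, |c k| * (C * C ^ (Finset.univ.erase k).card)) ?_ ?_ ?_ ?_
    · intro v
      have h1 : ∀ i ∈ (Finset.univ : Finset ι),
          HasDerivAt (fun v => G i (r i + c i * v)) (G' i (r i + c i * v) * c i) v := by
        intro i _
        have h2 : HasDerivAt (fun v => r i + c i * v) (c i) v := by
          simpa using ((hasDerivAt_id v).const_mul (c i)).const_add (r i)
        exact (hG i _).comp v h2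
      refine (HasDerivAt.fun_finsetProd h1).congr_deriv ?_
      refine Finset.sum_congr rfl fun k _ => ?_
      simp only [H, smul_eq_mul]
      ring
    · exact Finset.measurable_fun_sum _ fun k _ =>
        ((hHm k).comp (measurable_id.prodMk measurable_const)).const_mul _
    · exact fun v => abs_prod_le_of_abs_le fun i => hC _ _
    · intro v
      refine (Finset.abs_sum_le_sum_abs _ _).trans (Finset.sum_le_sum fun k _ => ?_)
      rw [abs_mul]
      exact mul_le_mul_of_nonneg_left (hHb k _) (abs_nonneg _)
  have hsi : Integrable (fun p => ∑ k, c k * H k p) ((gaussianReal 0 1).prod μR) :=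
    integrable_finsetSum _ fun k _ => (hHi k).const_mul _
  calc ∫ ω, V ω * ∏ i, G i (W i ω) ∂P
      = ∫ p, F p ∂((gaussianReal 0 1).prod μR) := by
        rw [← hmap, integral_map hVRm.aemeasurable hFm.aestronglyMeasurable]
        simp only [hFV]
    _ = ∫ p, ∑ k, c k * H k p ∂((gaussianReal 0 1).prod μR) := by
        rw [integral_prod_symm _ hFi, integral_prod_symm _ hsi]
        simp only [hinner]
    _ = ∑ k, c k * ∫ p, H k p ∂((gaussianReal 0 1).prod μR) := by
        rw [integral_finsetSum _ fun k _ => (hHi k).const_mul _]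
        simp only [integral_const_mul]
    _ = _ := by
        refine Finset.sum_congr rfl fun k _ => ?_
        rw [← hmap, integral_map hVRm.aemeasurable (hHm k).aestronglyMeasurable]
        simp only [hHV, hc]

/-! ### Interpolation by rotation. -/

/-- The rotation `cos θ X + sin θ Z` of a pair of random variables. -/
noncomputable def rotated {Ω : Type*} (X Z : Ω → ℝ) (θ : ℝ) (ω : Ω) : ℝ :=
  Real.cos θ * X ω + Real.sin θ * Z ω

/-- The derivative in the angle of `rotated`. -/
noncomputable def rotatedDeriv {Ω : Type*} (X Z : Ω → ℝ) (θ : ℝ) (ω : Ω) : ℝ :=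
  -Real.sin θ * X ω + Real.cos θ * Z ω

section Rotation

variable {Ω : Type*} [MeasurableSpace Ω] {P : Measure Ω} [IsProbabilityMeasure P]
  {X Z X' Z' : Ω → ℝ}

theorem covariance_linearComb (hX : MemLp X 2 P) (hZ : MemLp Z 2 P) (hX' : MemLp X' 2 P)
    (hZ' : MemLp Z' 2 P) (h1 : cov[X, Z'; P] = 0) (h2 : cov[Z, X'; P] = 0) (a b a' b' : ℝ) :
    cov[fun ω => a * X ω + b * Z ω, fun ω => a' * X' ω + b' * Z' ω; P] =
      a * a' * cov[X, X'; P] + b * b' * cov[Z, Z'; P] := by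
  have e1 := covariance_add_left (hX.const_mul a) (hZ.const_mul b)
    ((hX'.const_mul a').add (hZ'.const_mul b'))
  have e2 := covariance_add_right (hX.const_mul a) (hX'.const_mul a') (hZ'.const_mul b')
  have e3 := covariance_add_right (hZ.const_mul b) (hX'.const_mul a') (hZ'.const_mul b')
  simp only [covariance_const_mul_left, covariance_const_mul_right, h1, h2] at e1 e2 e3
  calc _ = _ := e1
    _ = _ := by rw [e2, e3]; ring

end Rotation

section Interpolation

variable {ι Ω : Type*} [Fintype ι] [MeasurableSpace Ω] {P : Measure Ω}
  {X Z : ι → Ω → ℝ}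

/-- Differentiation under the integral, dominated uniformly in θ by the sum of (|X i| + |Z i|) C.
Using `Function.update` for the differentiated factor keeps each term in the shape V ∏ G k (W k)
that integration by parts requires. -/
theorem hasDerivAt_integral_prod_rotated [DecidableEq ι] [IsProbabilityMeasure P]
    (hXm : ∀ i, Measurable (X i)) (hZm : ∀ i, Measurable (Z i))
    (hXi : ∀ i, Integrable (X i) P) (hZi : ∀ i, Integrable (Z i) P)
    {φ φ' : ι → ℝ → ℝ} {C : ℝ} (hφ : ∀ i x, HasDerivAt (φ i) (φ' i x) x)
    (hφ'm : ∀ i, Measurable (φ' i)) (h1 : ∀ i x, |φ i x| ≤ 1) (hC : ∀ i x, |φ' i x| ≤ C) (θ : ℝ) :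
    HasDerivAt (fun θ => ∫ ω, ∏ i, φ i (rotated (X i) (Z i) θ ω) ∂P)
      (∑ i, ∫ ω, rotatedDeriv (X i) (Z i) θ ω *
        ∏ k, Function.update φ i (φ' i) k (rotated (X k) (Z k) θ ω) ∂P) θ := by
  have hφm : ∀ i, Measurable (φ i) := fun i =>
    (continuous_iff_continuousAt.2 fun x => (hφ i x).continuousAt).measurable
  have hWm : ∀ i θ, Measurable (rotated (X i) (Z i) θ) := fun i θ =>
    ((hXm i).const_mul _).add ((hZm i).const_mul _)
  have hVm : ∀ i θ, Measurable (rotatedDeriv (X i) (Z i) θ) := fun i θ =>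
    ((hXm i).const_mul _).add ((hZm i).const_mul _)
  have hGm : ∀ i k, Measurable (Function.update φ i (φ' i) k) := by
    intro i k
    rcases eq_or_ne k i with rfl | hk
    · simpa using hφ'm k
    · simpa [Function.update_of_ne hk] using hφm k
  let T : ι → ℝ → Ω → ℝ := fun i θ ω => rotatedDeriv (X i) (Z i) θ ω *
        ∏ k, Function.update φ i (φ' i) k (rotated (X k) (Z k) θ ω)
  have hTm : ∀ i θ, Measurable (T i θ) := fun i θ =>
    (hVm i θ).mul (Finset.measurable_fun_prod _ fun k _ => (hGm i k).comp (hWm k θ))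
  have hprod : ∀ i θ ω, ∏ k, Function.update φ i (φ' i) k (rotated (X k) (Z k) θ ω) =
      φ' i (rotated (X i) (Z i) θ ω) *
        ∏ k ∈ Finset.univ.erase i, φ k (rotated (X k) (Z k) θ ω) := by
    intro i θ ω
    rw [← Finset.mul_prod_erase _ _ (Finset.mem_univ i)]
    simp only [Function.update_self]
    congr 1
    refine Finset.prod_congr rfl fun k hk => ?_
    rw [Function.update_of_ne (Finset.ne_of_mem_erase hk)]
  have hTb : ∀ i θ ω, |T i θ ω| ≤ (|X i ω| + |Z i ω|) * C := by
    intro i θ ω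
    simp only [T]
    rw [hprod, abs_mul, abs_mul]
    have hC0 : 0 ≤ C := (abs_nonneg _).trans (hC i 0)
    have h2 : |rotatedDeriv (X i) (Z i) θ ω| ≤ |X i ω| + |Z i ω| := by
      refine (abs_add_le _ _).trans (add_le_add ?_ ?_)
      · rw [abs_mul, abs_neg]
        exact mul_le_of_le_one_left (abs_nonneg _) (Real.abs_sin_le_one θ)
      · rw [abs_mul]
        exact mul_le_of_le_one_left (abs_nonneg _) (Real.abs_cos_le_one θ)
    have h3 : |∏ k ∈ Finset.univ.erase i, φ k (rotated (X k) (Z k) θ ω)| ≤ 1 := by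
      exact abs_prod_le_one _ fun k => h1 k _
    refine mul_le_mul h2 ?_ (by positivity) (by positivity)
    calc _ ≤ C * 1 := mul_le_mul (hC _ _) h3 (abs_nonneg _) hC0
      _ = C := mul_one C
  have hbi : ∀ i, Integrable (fun ω => (|X i ω| + |Z i ω|) * C) P := fun i =>
    ((hXi i).abs.add (hZi i).abs).mul_const C
  have key := (hasDerivAt_integral_of_dominated_loc_of_deriv_le (μ := P) (x₀ := θ)
    (F := fun θ ω => ∏ i, φ i (rotated (X i) (Z i) θ ω))
    (F' := fun θ ω => ∑ i, T i θ ω) (s := Set.univ)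
    (bound := fun ω => ∑ i, (|X i ω| + |Z i ω|) * C) univ_mem
    (Eventually.of_forall fun θ => (Finset.measurable_fun_prod _ fun k _ =>
      (hφm k).comp (hWm k θ)).aestronglyMeasurable) ?_
    (Finset.measurable_fun_sum _ fun i _ => hTm i θ).aestronglyMeasurable
    (Eventually.of_forall fun ω θ _ => ?_)
    (integrable_finsetSum _ fun i _ => hbi i)
    (Eventually.of_forall fun ω θ _ => ?_)).2
  · refine key.congr_deriv ?_
    rw [integral_finsetSum]
    intro i _
    exact (hbi i).mono' (hTm i θ).aestronglyMeasurable (Eventually.of_forall (hTb i θ))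
  · refine Integrable.of_bound (C := 1) (Finset.measurable_fun_prod _ fun k _ =>
      (hφm k).comp (hWm k θ)).aestronglyMeasurable (Eventually.of_forall fun ω => ?_)
    exact abs_prod_le_one _ fun k => h1 k _
  · exact (Finset.abs_sum_le_sum_abs _ _).trans (Finset.sum_le_sum fun i _ => hTb i θ ω)
  · have hd : ∀ i ∈ (Finset.univ : Finset ι), HasDerivAt
        (fun θ => φ i (rotated (X i) (Z i) θ ω))
        (φ' i (rotated (X i) (Z i) θ ω) * rotatedDeriv (X i) (Z i) θ ω) θ := by
      intro i _
      have : HasDerivAt (fun θ => rotated (X i) (Z i) θ ω) (rotatedDeriv (X i) (Z i) θ ω) θ :=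
        ((Real.hasDerivAt_cos θ).mul_const _).add ((Real.hasDerivAt_sin θ).mul_const _)
      exact (hφ i _).comp θ this
    refine (HasDerivAt.fun_finsetProd hd).congr_deriv ?_
    refine Finset.sum_congr rfl fun i _ => ?_
    simp only [T, hprod, smul_eq_mul]
    ring

theorem hasGaussianLaw_rotated
    (hXZ : HasGaussianLaw (fun ω => (fun i => X i ω, fun i => Z i ω)) P) (i : ι) (θ : ℝ) :
    HasGaussianLaw (fun ω => (rotatedDeriv (X i) (Z i) θ ω,
      fun k => rotated (X k) (Z k) θ ω)) P := by
  let p1 : ι → ((ι → ℝ) × (ι → ℝ) →L[ℝ] ℝ) := fun k =>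
    (ContinuousLinearMap.proj k).comp (ContinuousLinearMap.fst ℝ (ι → ℝ) (ι → ℝ))
  let p2 : ι → ((ι → ℝ) × (ι → ℝ) →L[ℝ] ℝ) := fun k =>
    (ContinuousLinearMap.proj k).comp (ContinuousLinearMap.snd ℝ (ι → ℝ) (ι → ℝ))
  let A : (ι → ℝ) × (ι → ℝ) →L[ℝ] ℝ × (ι → ℝ) :=
    ((-Real.sin θ) • p1 i + Real.cos θ • p2 i).prod
      (ContinuousLinearMap.pi fun k => Real.cos θ • p1 k + Real.sin θ • p2 k)
  have h : (fun ω => (rotatedDeriv (X i) (Z i) θ ω, fun k => rotated (X k) (Z k) θ ω)) =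
      A ∘ fun ω => (fun i => X i ω, fun i => Z i ω) := by
    ext ω <;> simp [A, p1, p2, rotated, rotatedDeriv]
  rw [h]
  exact hXZ.map A

/-- Comparison of the expectations of a product of smooth functions for a Gaussian vector with unit
variances and for a Gaussian vector with independent coordinates. -/
theorem abs_integral_prod_sub_integral_prod_le [DecidableEq ι]
    (hXm : ∀ i, Measurable (X i)) (hZm : ∀ i, Measurable (Z i))
    (hXZ : HasGaussianLaw (fun ω => (fun i => X i ω, fun i => Z i ω)) P)
    (hX0 : ∀ i, ∫ ω, X i ω ∂P = 0) (hZ0 : ∀ i, ∫ ω, Z i ω ∂P = 0)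
    (hX1 : ∀ i, Var[X i; P] = 1) (hZ1 : ∀ i, Var[Z i; P] = 1)
    (hZc : ∀ i j, i ≠ j → cov[Z i, Z j; P] = 0) (hXZc : ∀ i j, cov[X i, Z j; P] = 0)
    {φ φ' φ'' : ι → ℝ → ℝ} {C : ℝ} (hφ : ∀ i x, HasDerivAt (φ i) (φ' i x) x)
    (hφ' : ∀ i x, HasDerivAt (φ' i) (φ'' i x) x) (hφ''m : ∀ i, Measurable (φ'' i))
    (h1 : ∀ i x, |φ i x| ≤ 1) (hC1 : 1 ≤ C) (hC : ∀ i x, |φ' i x| ≤ C)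
    (hC' : ∀ i x, |φ'' i x| ≤ C) {B : ι → ι → ℝ}
    (hB : ∀ θ i j, i ≠ j → ∫ ω, |φ' i (rotated (X i) (Z i) θ ω)| *
      |φ' j (rotated (X j) (Z j) θ ω)| ∂P ≤ B i j) :
    |∫ ω, ∏ i, φ i (X i ω) ∂P - ∫ ω, ∏ i, φ i (Z i ω) ∂P| ≤
      Real.pi / 2 * ∑ i, ∑ j ∈ Finset.univ.erase i, |cov[X i, X j; P]| * B i j := by
  have hprob := hXZ.isProbabilityMeasure
  have hφ'm : ∀ i, Measurable (φ' i) := fun i =>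
    (continuous_iff_continuousAt.2 fun x => (hφ' i x).continuousAt).measurable
  have hX2 : ∀ i, MemLp (X i) 2 P := fun i => (hXZ.fst.eval i).memLp_two
  have hZ2 : ∀ i, MemLp (Z i) 2 P := fun i => (hXZ.snd.eval i).memLp_two
  have hXi : ∀ i, Integrable (X i) P := fun i => (hX2 i).integrable (by norm_num)
  have hZi : ∀ i, Integrable (Z i) P := fun i => (hZ2 i).integrable (by norm_num)
  have hWm : ∀ i θ, Measurable (rotated (X i) (Z i) θ) := fun i θ =>
    ((hXm i).const_mul _).add ((hZm i).const_mul _)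
  have hVm : ∀ i θ, Measurable (rotatedDeriv (X i) (Z i) θ) := fun i θ =>
    ((hXm i).const_mul _).add ((hZm i).const_mul _)
  have hcov : ∀ i j θ, cov[rotatedDeriv (X i) (Z i) θ, rotated (X j) (Z j) θ; P] =
      Real.sin θ * Real.cos θ * (cov[Z i, Z j; P] - cov[X i, X j; P]) := by
    intro i j θ
    have := covariance_linearComb (hX2 i) (hZ2 i) (hX2 j) (hZ2 j) (hXZc i j)
      (by rw [covariance_comm]; exact hXZc j i) (-Real.sin θ) (Real.cos θ) (Real.cos θ)
      (Real.sin θ)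
    refine Eq.trans this ?_
    ring
  have hvar : ∀ i θ, Var[rotatedDeriv (X i) (Z i) θ; P] = 1 := by
    intro i θ
    rw [← covariance_self (hVm i θ).aemeasurable]
    have := covariance_linearComb (hX2 i) (hZ2 i) (hX2 i) (hZ2 i) (hXZc i i)
      (by rw [covariance_comm]; exact hXZc i i) (-Real.sin θ) (Real.cos θ) (-Real.sin θ)
      (Real.cos θ)
    refine Eq.trans this ?_
    rw [covariance_self (hXm i).aemeasurable, covariance_self (hZm i).aemeasurable, hX1, hZ1]
    nlinarith [Real.sin_sq_add_cos_sq θ]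
  have hmean : ∀ i θ, ∫ ω, rotatedDeriv (X i) (Z i) θ ω ∂P = 0 := by
    intro i θ
    simp only [rotatedDeriv]
    rw [integral_add ((hXi i).const_mul _) ((hZi i).const_mul _), integral_const_mul,
      integral_const_mul, hX0, hZ0]
    simp
  set D := ∑ i, ∑ j ∈ Finset.univ.erase i, |cov[X i, X j; P]| * B i j with hD
  have hderiv := hasDerivAt_integral_prod_rotated hXm hZm hXi hZi hφ hφ'm h1 hC
  have hbound : ∀ θ, |∑ i, ∫ ω, rotatedDeriv (X i) (Z i) θ ω *
        ∏ k, Function.update φ i (φ' i) k (rotated (X k) (Z k) θ ω) ∂P| ≤ D := by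
    intro θ
    refine (Finset.abs_sum_le_sum_abs _ _).trans (Finset.sum_le_sum fun i _ => ?_)
    rw [integral_mul_prod_of_hasGaussianLaw (hVm i θ) (fun k => hWm k θ)
      (hasGaussianLaw_rotated hXZ i θ) (hmean i θ) (hvar i θ)
      (G' := Function.update φ' i (φ'' i)) (C := C)]
    rotate_left
    · intro k x
      rcases eq_or_ne k i with rfl | hk
      · simpa using hφ' k x
      · simpa [Function.update_of_ne hk] using hφ k x
    · intro k
      rcases eq_or_ne k i with rfl | hk
      · simpa using hφ''m k
      · simpa [Function.update_of_ne hk] using hφ'm k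
    · intro k x
      rcases eq_or_ne k i with rfl | hk
      · simpa using hC k x
      · simpa [Function.update_of_ne hk] using (h1 k x).trans hC1
    · intro k x
      rcases eq_or_ne k i with rfl | hk
      · simpa using hC' k x
      · simpa [Function.update_of_ne hk] using hC k x
    rw [← Finset.add_sum_erase _ _ (Finset.mem_univ i)]
    -- Equal unit variances kill the diagonal term, so φ'' never enters the final bound.
    have h0 : cov[rotatedDeriv (X i) (Z i) θ, rotated (X i) (Z i) θ; P] = 0 := by
      rw [hcov, covariance_self (hXm i).aemeasurable, covariance_self (hZm i).aemeasurable,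
        hX1, hZ1]
      simp
    rw [h0, zero_mul, zero_add]
    refine (Finset.abs_sum_le_sum_abs _ _).trans (Finset.sum_le_sum fun k hk => ?_)
    have hki := Finset.ne_of_mem_erase hk
    rw [abs_mul, hcov, hZc i k hki.symm, zero_sub, abs_mul, abs_neg]
    have hsc : |Real.sin θ * Real.cos θ| ≤ 1 := by
      rw [abs_mul]
      exact mul_le_one₀ (Real.abs_sin_le_one θ) (abs_nonneg _) (Real.abs_cos_le_one θ)
    refine mul_le_mul (mul_le_of_le_one_left (abs_nonneg _) hsc) ?_ (abs_nonneg _) (abs_nonneg _)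
    refine le_trans ?_ (hB θ i k hki.symm)
    refine (abs_integral_le_integral_abs).trans (integral_mono_of_nonneg
      (Eventually.of_forall fun ω => abs_nonneg _) ?_ (Eventually.of_forall fun ω => ?_))
    · refine Integrable.of_bound (C := C * C) ?_ (Eventually.of_forall fun ω => ?_)
      · exact (((hφ'm i).comp (hWm i θ)).abs.mul ((hφ'm k).comp (hWm k θ)).abs).aestronglyMeasurable
      · rw [Real.norm_eq_abs, abs_mul, abs_abs, abs_abs]
        exact mul_le_mul (hC _ _) (hC _ _) (abs_nonneg _) (by linarith)
    · simp only
      rw [Function.update_of_ne hki, abs_mul,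
        ← Finset.mul_prod_erase (Finset.univ.erase k) _
          (Finset.mem_erase.2 ⟨hki.symm, Finset.mem_univ i⟩), Function.update_self, abs_mul]
      have hp : |∏ l ∈ (Finset.univ.erase k).erase i,
          Function.update φ i (φ' i) l (rotated (X l) (Z l) θ ω)| ≤ 1 := by
        rw [Finset.prod_congr rfl (g := fun l => φ l (rotated (X l) (Z l) θ ω))]
        · exact abs_prod_le_one _ fun l => h1 l _
        · intro l hl
          rw [Function.update_of_ne (Finset.ne_of_mem_erase hl)]
      calc _ ≤ |φ' k (rotated (X k) (Z k) θ ω)| * (|φ' i (rotated (X i) (Z i) θ ω)| * 1) := by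
            gcongr
        _ = _ := by ring
  -- The angle 0 gives X and π/2 gives Z; the length of this interval is the constant π/2 of the
  -- bound.
  have mvt := (convex_univ (𝕜 := ℝ) (E := ℝ)).norm_image_sub_le_of_norm_hasDerivWithin_le
    (fun θ _ => (hderiv θ).hasDerivWithinAt) (fun θ _ => hbound θ)
    (Set.mem_univ (Real.pi / 2)) (Set.mem_univ 0)
  simp only [rotated, Real.cos_zero, Real.sin_zero, Real.cos_pi_div_two, Real.sin_pi_div_two,
    one_mul, zero_mul, add_zero, zero_add, Real.norm_eq_abs, zero_sub, abs_neg] at mvt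
  rwa [abs_of_pos (by positivity : (0 : ℝ) < Real.pi / 2), mul_comm] at mvt

end Interpolation

/-! ### Smooth approximation of half-line indicators. -/

/-- A smooth nonincreasing function equal to `1` on `(-∞, v]` and to `0` on `[v + h, ∞)`. -/
noncomputable def smoothCutoff (v h x : ℝ) : ℝ := 1 - Real.smoothTransition ((x - v) / h)

namespace smoothCutoff

variable {v h : ℝ}

theorem nonneg (x : ℝ) : 0 ≤ smoothCutoff v h x :=
  sub_nonneg.2 (Real.smoothTransition.le_one _)

theorem le_one (x : ℝ) : smoothCutoff v h x ≤ 1 :=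
  sub_le_self _ (Real.smoothTransition.nonneg _)

theorem abs_le_one (x : ℝ) : |smoothCutoff v h x| ≤ 1 :=
  abs_le.2 ⟨by linarith [nonneg (v := v) (h := h) x], le_one x⟩

theorem eq_one (hh : 0 < h) {x : ℝ} (hx : x ≤ v) : smoothCutoff v h x = 1 := by
  rw [smoothCutoff, Real.smoothTransition.zero_of_nonpos, sub_zero]
  exact div_nonpos_of_nonpos_of_nonneg (by linarith) hh.le

theorem eq_zero (hh : 0 < h) {x : ℝ} (hx : v + h ≤ x) : smoothCutoff v h x = 0 := by
  rw [smoothCutoff, Real.smoothTransition.one_of_one_le, sub_self]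
  rw [le_div_iff₀ hh]; linarith

theorem contDiff (n : ℕ∞) : ContDiff ℝ n (smoothCutoff v h) :=
  contDiff_const.sub (Real.smoothTransition.contDiff.comp
    ((contDiff_id.sub contDiff_const).div_const h))

theorem continuous : Continuous (smoothCutoff v h) := (contDiff 0).continuous

theorem hasDerivAt (x : ℝ) : HasDerivAt (smoothCutoff v h) (deriv (smoothCutoff v h) x) x :=
  (((contDiff 1).differentiable one_ne_zero) x).hasDerivAt

theorem contDiff_deriv (n : ℕ) : ContDiff ℝ n (deriv (smoothCutoff v h)) := by
  have : ContDiff ℝ (n + 1) (smoothCutoff v h) := contDiff (n + 1 : ℕ)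
  exact this.deriv'

theorem hasDerivAt_deriv (x : ℝ) :
    HasDerivAt (deriv (smoothCutoff v h)) (deriv (deriv (smoothCutoff v h)) x) x :=
  (((contDiff_deriv 1).differentiable (by norm_num)) x).hasDerivAt

theorem continuous_deriv : Continuous (deriv (smoothCutoff v h)) :=
  (contDiff_deriv 0).continuous

theorem continuous_deriv_deriv : Continuous (deriv (deriv (smoothCutoff v h))) :=
  (contDiff_deriv 1).continuous_deriv (by norm_num)

theorem antitone (hh : 0 < h) : Antitone (smoothCutoff v h) := fun x y hxy =>
  sub_le_sub_left (Real.smoothTransition.monotone (by gcongr)) 1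

theorem deriv_nonpos (hh : 0 < h) (x : ℝ) : deriv (smoothCutoff v h) x ≤ 0 :=
  (antitone hh).deriv_nonpos

theorem deriv_eq_zero_of_lt (hh : 0 < h) {x : ℝ} (hx : x < v) :
    deriv (smoothCutoff v h) x = 0 := by
  have : smoothCutoff v h =ᶠ[𝓝 x] fun _ => 1 := by
    filter_upwards [Iio_mem_nhds hx] with y hy
    exact eq_one hh (le_of_lt hy)
  rw [this.deriv_eq, deriv_const]

theorem deriv_eq_zero_of_gt (hh : 0 < h) {x : ℝ} (hx : v + h < x) :
    deriv (smoothCutoff v h) x = 0 := by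
  have : smoothCutoff v h =ᶠ[𝓝 x] fun _ => 0 := by
    filter_upwards [Ioi_mem_nhds hx] with y hy
    exact eq_zero hh (le_of_lt hy)
  rw [this.deriv_eq, deriv_const]

theorem hasCompactSupport_deriv (hh : 0 < h) : HasCompactSupport (deriv (smoothCutoff v h)) := by
  refine HasCompactSupport.intro (isCompact_Icc (a := v) (b := v + h)) fun x hx => ?_
  by_cases h1 : x < v
  · exact deriv_eq_zero_of_lt hh h1
  · exact deriv_eq_zero_of_gt hh (not_le.1 fun h2 => hx ⟨not_lt.1 h1, h2⟩)

theorem exists_bound (hh : 0 < h) : ∃ C, ∀ x, |deriv (smoothCutoff v h) x| ≤ C ∧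
    |deriv (deriv (smoothCutoff v h)) x| ≤ C := by
  obtain ⟨C₁, h₁⟩ := continuous_deriv.bounded_above_of_compact_support
    (hasCompactSupport_deriv (v := v) hh)
  obtain ⟨C₂, h₂⟩ := continuous_deriv_deriv.bounded_above_of_compact_support
    (hasCompactSupport_deriv (v := v) hh).deriv
  exact ⟨max C₁ C₂, fun x => ⟨(h₁ x).trans (le_max_left _ _), (h₂ x).trans (le_max_right _ _)⟩⟩

/-- A monotone descent from 1 to 0 has total variation 1 whatever its width; this makes the
comparison bound independent of h. -/
theorem lintegral_abs_deriv (hh : 0 < h) :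
    ∫⁻ x, ENNReal.ofReal |deriv (smoothCutoff v h) x| ≤ 1 := by
  have hint : Integrable (deriv (smoothCutoff v h)) :=
    continuous_deriv.integrable_of_hasCompactSupport (hasCompactSupport_deriv hh)
  have hbot : Tendsto (smoothCutoff v h) atBot (𝓝 1) := by
    refine tendsto_const_nhds.congr' ?_
    filter_upwards [eventually_le_atBot v] with x hx using (eq_one hh hx).symm
  have htop : Tendsto (smoothCutoff v h) atTop (𝓝 0) := by
    refine tendsto_const_nhds.congr' ?_
    filter_upwards [eventually_ge_atTop (v + h)] with x hx using (eq_zero hh hx).symm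
  have hI := integral_of_hasDerivAt_of_tendsto hasDerivAt hint hbot htop
  rw [← ofReal_integral_eq_lintegral_ofReal hint.abs (Eventually.of_forall fun _ => abs_nonneg _)]
  have : ∫ x, |deriv (smoothCutoff v h) x| = 1 := by
    simp only [abs_of_nonpos (deriv_nonpos hh _)]
    rw [integral_neg, hI]; norm_num
  rw [this]; simp

theorem tendsto_indicator (v x : ℝ) {u : ℕ → ℝ} (hu : ∀ n, 0 < u n) (hu0 : Tendsto u atTop (𝓝 0)) :
    Tendsto (fun n => smoothCutoff v (u n) x) atTop
      (𝓝 ((Set.Iic v).indicator (fun _ => (1 : ℝ)) x)) := by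
  rcases le_or_gt x v with hx | hx
  · rw [Set.indicator_of_mem (Set.mem_Iic.2 hx)]
    exact tendsto_const_nhds.congr fun n => (eq_one (hu n) hx).symm
  · rw [Set.indicator_of_notMem (by simpa using hx)]
    refine tendsto_const_nhds.congr' ?_
    filter_upwards [hu0.eventually_lt_const (sub_pos.2 hx)] with n hn
    exact (eq_zero (hu n) (by linarith)).symm

end smoothCutoff

/-- Smoothed probabilities of orthants converge to the probabilities of orthants. -/
theorem tendsto_integral_prod_smoothCutoff {ι Ω : Type*} [Fintype ι] [MeasurableSpace Ω]
    {P : Measure Ω} [IsProbabilityMeasure P] {X : ι → Ω → ℝ} (hX : ∀ i, Measurable (X i))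
    (v : ι → ℝ) {u : ℕ → ℝ} (hu : ∀ n, 0 < u n) (hu0 : Tendsto u atTop (𝓝 0)) :
    Tendsto (fun n => ∫ ω, ∏ i, smoothCutoff (v i) (u n) (X i ω) ∂P) atTop
      (𝓝 (P.real {ω | ∀ i, X i ω ≤ v i})) := by
  have hm : MeasurableSet {ω | ∀ i, X i ω ≤ v i} := by
    rw [Set.ofPred_forall]
    exact MeasurableSet.iInter fun i => measurableSet_le (hX i) measurable_const
  have e : P.real {ω | ∀ i, X i ω ≤ v i} =
      ∫ ω, ∏ i, (Set.Iic (v i)).indicator (fun _ => (1 : ℝ)) (X i ω) ∂P := by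
    rw [← integral_indicator_one hm]
    congr 1
    ext ω
    by_cases h : ∀ i, X i ω ≤ v i
    · have h' : ω ∈ {ω | ∀ i, X i ω ≤ v i} := by rw [Set.mem_ofPred]; exact h
      rw [Set.indicator_of_mem h', Finset.prod_eq_one]
      · rfl
      · intro i _
        rw [Set.indicator_of_mem (Set.mem_Iic.2 (h i))]
    · have h' : ω ∉ {ω | ∀ i, X i ω ≤ v i} := by rw [Set.mem_ofPred]; exact h
      rw [Set.indicator_of_notMem h']
      push Not at h
      obtain ⟨i, hi⟩ := h
      rw [Finset.prod_eq_zero (Finset.mem_univ i)]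
      rw [Set.indicator_of_notMem (by simpa using hi)]
  rw [e]
  refine tendsto_integral_of_dominated_convergence (fun _ => 1) (fun n => ?_)
    (integrable_const 1) (fun n => Eventually.of_forall fun ω => ?_)
    (Eventually.of_forall fun ω => ?_)
  · exact (Finset.measurable_fun_prod _ fun i _ =>
      smoothCutoff.continuous.measurable.comp (hX i)).aestronglyMeasurable
  · exact abs_prod_le_one _ fun i => smoothCutoff.abs_le_one _
  · exact tendsto_finsetProd _ fun i _ => smoothCutoff.tendsto_indicator _ _ hu hu0

/-! ### The normal comparison inequality. -/

/-- The bound on the density of a bivariate normal vector in the normal comparison inequality. -/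
noncomputable def comparisonWeight (δ u r : ℝ) : ℝ :=
  (2 * Real.pi * √(1 - δ ^ 2))⁻¹ * Real.exp (-u ^ 2 / (1 + r))

theorem comparisonWeight_nonneg (δ u r : ℝ) : 0 ≤ comparisonWeight δ u r := by
  rw [comparisonWeight]; positivity

section

variable {ι Ω : Type*} [Fintype ι] [MeasurableSpace Ω] {P : Measure Ω}
  {X Z : ι → Ω → ℝ}

/-- Rotation multiplies the off-diagonal covariances of X by cos²θ, so the density bound for the
correlation of X serves all angles. The derivatives of the cutoffs live above u and have mass at
most 1. -/
theorem integral_abs_deriv_rotated_le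
    (hXZ : HasGaussianLaw (fun ω => (fun i => X i ω, fun i => Z i ω)) P)
    (hX0 : ∀ i, ∫ ω, X i ω ∂P = 0) (hZ0 : ∀ i, ∫ ω, Z i ω ∂P = 0)
    (hX1 : ∀ i, Var[X i; P] = 1) (hZ1 : ∀ i, Var[Z i; P] = 1)
    (hZc : ∀ i j, i ≠ j → cov[Z i, Z j; P] = 0) (hXZc : ∀ i j, cov[X i, Z j; P] = 0)
    {δ u h : ℝ} (hδ : δ < 1) (hu : 0 ≤ u) (hh : 0 < h) {v : ι → ℝ} (hv : ∀ i, u ≤ v i)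
    (hc : ∀ i j, i ≠ j → |cov[X i, X j; P]| ≤ δ) (θ : ℝ) (i j : ι) (hij : i ≠ j) :
    ∫ ω, |deriv (smoothCutoff (v i) h) (rotated (X i) (Z i) θ ω)| *
      |deriv (smoothCutoff (v j) h) (rotated (X j) (Z j) θ ω)| ∂P ≤
        comparisonWeight δ u |cov[X i, X j; P]| := by
  have hprob := hXZ.isProbabilityMeasure
  have hX2 : ∀ i, MemLp (X i) 2 P := fun i => (hXZ.fst.eval i).memLp_two
  have hZ2 : ∀ i, MemLp (Z i) 2 P := fun i => (hXZ.snd.eval i).memLp_two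
  have hXi : ∀ i, Integrable (X i) P := fun i => (hX2 i).integrable (by norm_num)
  have hZi : ∀ i, Integrable (Z i) P := fun i => (hZ2 i).integrable (by norm_num)
  have hW := (hasGaussianLaw_rotated hXZ i θ).snd
  have hWij := hW.prodMk i j
  have hWm : ∀ k, AEMeasurable (rotated (X k) (Z k) θ) P := fun k => (hW.eval k).aemeasurable
  have hmean : ∀ i, ∫ ω, rotated (X i) (Z i) θ ω ∂P = 0 := by
    intro i
    simp only [rotated]
    rw [integral_add ((hXi i).const_mul _) ((hZi i).const_mul _), integral_const_mul,
      integral_const_mul, hX0, hZ0]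
    simp
  have hcov : ∀ i j, cov[rotated (X i) (Z i) θ, rotated (X j) (Z j) θ; P] =
      Real.cos θ * Real.cos θ * cov[X i, X j; P] + Real.sin θ * Real.sin θ * cov[Z i, Z j; P] :=
    fun i j => covariance_linearComb (hX2 i) (hZ2 i) (hX2 j) (hZ2 j) (hXZc i j)
      (by rw [covariance_comm]; exact hXZc j i) _ _ _ _
  have hvar : ∀ i, Var[rotated (X i) (Z i) θ; P] = 1 := by
    intro i
    rw [← covariance_self (hWm i), hcov, covariance_self (hXZ.fst.eval i).aemeasurable,
      covariance_self (hXZ.snd.eval i).aemeasurable, hX1, hZ1]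
    nlinarith [Real.sin_sq_add_cos_sq θ]
  have hle : |cov[rotated (X i) (Z i) θ, rotated (X j) (Z j) θ; P]| ≤ |cov[X i, X j; P]| := by
    rw [hcov, hZc i j hij, mul_zero, add_zero, abs_mul]
    refine mul_le_of_le_one_left (abs_nonneg _) ?_
    rw [abs_mul]
    exact mul_le_one₀ (Real.abs_cos_le_one θ) (abs_nonneg _) (Real.abs_cos_le_one θ)
  have hdm : ∀ k, Measurable fun x => ENNReal.ofReal |deriv (smoothCutoff (v k) h) x| := fun k =>
    (smoothCutoff.continuous_deriv.abs.measurable).ennreal_ofReal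
  have hsupp : ∀ k, ∀ x < u, ENNReal.ofReal |deriv (smoothCutoff (v k) h) x| = 0 := by
    intro k x hx
    rw [smoothCutoff.deriv_eq_zero_of_lt hh (hx.trans_le (hv k))]; simp
  have key := lintegral_mul_le_of_hasGaussianLaw hWij (hmean i) (hmean j) (hvar i) (hvar j)
    hle (hc i j hij) hδ hu (hdm i) (hdm j) (hsupp i) (hsupp j)
    (smoothCutoff.lintegral_abs_deriv hh) (smoothCutoff.lintegral_abs_deriv hh)
  rw [integral_eq_lintegral_of_nonneg_ae
    (Eventually.of_forall fun ω => mul_nonneg (abs_nonneg _) (abs_nonneg _))]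
  · refine ENNReal.toReal_le_of_le_ofReal (comparisonWeight_nonneg _ _ _) ?_
    simpa only [ENNReal.ofReal_mul (abs_nonneg _), comparisonWeight] using key
  · exact ((smoothCutoff.continuous_deriv.abs.measurable.comp_aemeasurable (hWm i)).mul
      (smoothCutoff.continuous_deriv.abs.measurable.comp_aemeasurable
        (hWm j))).aestronglyMeasurable

/-- The smooth comparison holds with the same bound for every cutoff width, so it survives the limit
of vanishing width. -/
theorem abs_measureReal_sub_measureReal_le [DecidableEq ι]
    (hXm : ∀ i, Measurable (X i)) (hZm : ∀ i, Measurable (Z i))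
    (hXZ : HasGaussianLaw (fun ω => (fun i => X i ω, fun i => Z i ω)) P)
    (hX0 : ∀ i, ∫ ω, X i ω ∂P = 0) (hZ0 : ∀ i, ∫ ω, Z i ω ∂P = 0)
    (hX1 : ∀ i, Var[X i; P] = 1) (hZ1 : ∀ i, Var[Z i; P] = 1)
    (hZc : ∀ i j, i ≠ j → cov[Z i, Z j; P] = 0) (hXZc : ∀ i j, cov[X i, Z j; P] = 0)
    {δ u : ℝ} (hδ : δ < 1) (hu : 0 ≤ u) {v : ι → ℝ} (hv : ∀ i, u ≤ v i)
    (hc : ∀ i j, i ≠ j → |cov[X i, X j; P]| ≤ δ) :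
    |P.real {ω | ∀ i, X i ω ≤ v i} - P.real {ω | ∀ i, Z i ω ≤ v i}| ≤
      Real.pi / 2 * ∑ i, ∑ j ∈ Finset.univ.erase i,
        |cov[X i, X j; P]| * comparisonWeight δ u |cov[X i, X j; P]| := by
  have hprob := hXZ.isProbabilityMeasure
  have hw0 : Tendsto (fun n : ℕ => 1 / ((n : ℝ) + 1)) atTop (𝓝 0) :=
    tendsto_one_div_add_atTop_nhds_zero_nat
  have hw : ∀ n : ℕ, 0 < 1 / ((n : ℝ) + 1) := fun n => Nat.one_div_pos_of_nat
  refine le_of_tendsto ((tendsto_integral_prod_smoothCutoff hXm v hw hw0).sub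
    (tendsto_integral_prod_smoothCutoff hZm v hw hw0)).abs (Eventually.of_forall fun n => ?_)
  -- These bounds blow up as the width shrinks, but they only serve integrability and are absent
  -- from the estimate.
  choose C hC using fun i => smoothCutoff.exists_bound (v := v i) (hw n)
  have hCs : ∀ i, C i ≤ 1 + ∑ i, |C i| := fun i => by
    linarith [le_abs_self (C i), Finset.single_le_sum (f := fun i => |C i|)
      (fun _ _ => abs_nonneg _) (Finset.mem_univ i)]
  refine abs_integral_prod_sub_integral_prod_le hXm hZm hXZ hX0 hZ0 hX1 hZ1 hZc hXZc
    (fun i x => smoothCutoff.hasDerivAt x) (fun i x => smoothCutoff.hasDerivAt_deriv x)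
    (fun i => smoothCutoff.continuous_deriv_deriv.measurable)
    (fun i x => smoothCutoff.abs_le_one x) (C := 1 + ∑ i, |C i|) ?_
    (fun i x => ((hC i x).1).trans (hCs i)) (fun i x => ((hC i x).2).trans (hCs i))
    (B := fun i j => comparisonWeight δ u |cov[X i, X j; P]|)
    (fun θ i j hij => integral_abs_deriv_rotated_le hXZ hX0 hZ0 hX1 hZ1 hZc hXZc hδ hu (hw n)
      hv hc θ i j hij)
  linarith [Finset.sum_nonneg fun i (_ : i ∈ Finset.univ) => abs_nonneg (C i)]

/-- Berman's normal comparison inequality with an independent standard Gaussian vector. -/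
theorem abs_measureReal_sub_prod_le [DecidableEq ι] (hXm : ∀ i, Measurable (X i))
    (hX : HasGaussianLaw (fun ω i => X i ω) P)
    (hX0 : ∀ i, ∫ ω, X i ω ∂P = 0) (hX1 : ∀ i, Var[X i; P] = 1)
    {δ u : ℝ} (hδ : δ < 1) (hu : 0 ≤ u) {v : ι → ℝ} (hv : ∀ i, u ≤ v i)
    (hc : ∀ i j, i ≠ j → |cov[X i, X j; P]| ≤ δ) :
    |P.real {ω | ∀ i, X i ω ≤ v i} - ∏ i, (gaussianReal 0 1).real (Set.Iic (v i))| ≤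
      Real.pi / 2 * ∑ i, ∑ j ∈ Finset.univ.erase i,
        |cov[X i, X j; P]| * comparisonWeight δ u |cov[X i, X j; P]| := by
  have hprob := hX.isProbabilityMeasure
  -- Enlarging the probability space supplies a standard Gaussian vector independent of X.
  let γ : Measure (ι → ℝ) := Measure.pi fun _ => gaussianReal 0 1
  let Q : Measure (Ω × (ι → ℝ)) := P.prod γ
  let X' : ι → Ω × (ι → ℝ) → ℝ := fun i p => X i p.1
  let Z' : ι → Ω × (ι → ℝ) → ℝ := fun i p => p.2 i
  have hX'm : ∀ i, Measurable (X' i) := fun i => (hXm i).comp measurable_fst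
  have hZ'm : ∀ i, Measurable (Z' i) := fun i => (measurable_pi_apply i).comp measurable_snd
  have hfst : MeasurePreserving (Prod.fst : Ω × (ι → ℝ) → Ω) Q P := measurePreserving_fst
  have hsnd : MeasurePreserving (Prod.snd : Ω × (ι → ℝ) → (ι → ℝ)) Q γ := measurePreserving_snd
  have hev : ∀ i, MeasurePreserving (Z' i) Q (gaussianReal 0 1) := fun i =>
    (measurePreserving_eval (fun _ : ι => gaussianReal 0 1) i).comp hsnd
  have hXm' : Measurable fun ω i => X i ω := measurable_pi_lambda _ hXm
  have gX : HasGaussianLaw (fun p i => X' i p) Q := by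
    constructor
    have : Q.map (fun p i => X' i p) = P.map fun ω i => X i ω := by
      rw [← hfst.map_eq, Measure.map_map hXm' measurable_fst]
      rfl
    rw [this]
    exact hX.isGaussian_map
  have indZ : iIndepFun Z' Q := by
    have h := iIndepFun_pi (μ := fun _ : ι => gaussianReal 0 1) (X := fun _ x => x)
      (fun _ => aemeasurable_id)
    rw [iIndepFun_iff_map_fun_eq_pi_map (fun i => (measurable_pi_apply i).aemeasurable)] at h
    rw [iIndepFun_iff_map_fun_eq_pi_map (fun i => (hZ'm i).aemeasurable)]
    simp only [fun i => (hev i).map_eq]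
    have : Q.map (fun p i => Z' i p) = γ := hsnd.map_eq
    rw [this]
  have gZ1 : ∀ i, HasGaussianLaw (Z' i) Q := fun i => ⟨by
    rw [(hev i).map_eq]; infer_instance⟩
  have gZ : HasGaussianLaw (fun p i => Z' i p) Q := indZ.hasGaussianLaw gZ1
  have indXZ : IndepFun (fun p i => X' i p) (fun p i => Z' i p) Q :=
    indepFun_prod (X := fun ω i => X i ω) (Y := fun x : ι → ℝ => x) hXm' measurable_id
  have gXZ := indXZ.hasGaussianLaw gX gZ
  have hX'0 : ∀ i, ∫ p, X' i p ∂Q = 0 := by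
    intro i
    rw [← hX0 i, ← hfst.map_eq, integral_map measurable_fst.aemeasurable
      (hXm i).aestronglyMeasurable]
  have hZ'0 : ∀ i, ∫ p, Z' i p ∂Q = 0 := by
    intro i
    have := integral_map (μ := Q) (hZ'm i).aemeasurable (f := fun x : ℝ => x)
      measurable_id.aestronglyMeasurable
    rw [← this, (hev i).map_eq, integral_id_gaussianReal]
  have hX'c : ∀ i j, cov[X' i, X' j; Q] = cov[X i, X j; P] := by
    intro i j
    rw [← hfst.map_eq, covariance_map (hXm i).aestronglyMeasurable (hXm j).aestronglyMeasurable
      measurable_fst.aemeasurable]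
    rfl
  have hX'1 : ∀ i, Var[X' i; Q] = 1 := by
    intro i
    rw [← covariance_self (hX'm i).aemeasurable, hX'c, covariance_self (hXm i).aemeasurable, hX1]
  have hZ'1 : ∀ i, Var[Z' i; Q] = 1 := by
    intro i
    rw [← variance_id_map (hZ'm i).aemeasurable, (hev i).map_eq, variance_id_gaussianReal]
    rfl
  have hZ'c : ∀ i j, i ≠ j → cov[Z' i, Z' j; Q] = 0 := fun i j hij =>
    (indZ.indepFun hij).covariance_eq_zero (gZ1 i).memLp_two (gZ1 j).memLp_two
  have hXZ'c : ∀ i j, cov[X' i, Z' j; Q] = 0 := fun i j =>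
    (indXZ.comp (measurable_pi_apply i) (measurable_pi_apply j)).covariance_eq_zero
      (gX.eval i).memLp_two (gZ1 j).memLp_two
  have key := abs_measureReal_sub_measureReal_le hX'm hZ'm gXZ hX'0 hZ'0 hX'1 hZ'1 hZ'c hXZ'c
    hδ hu hv (fun i j hij => by rw [hX'c]; exact hc i j hij)
  simp only [hX'c] at key
  have eX : Q.real {p | ∀ i, X' i p ≤ v i} = P.real {ω | ∀ i, X i ω ≤ v i} := by
    refine hfst.measureReal_preimage (s := {ω | ∀ i, X i ω ≤ v i}) ?_
    rw [Set.ofPred_forall]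
    exact (MeasurableSet.iInter fun i =>
      measurableSet_le (hXm i) measurable_const).nullMeasurableSet
  have eZ : Q.real {p | ∀ i, Z' i p ≤ v i} = ∏ i, (gaussianReal 0 1).real (Set.Iic (v i)) := by
    have h1 : {x : ι → ℝ | ∀ i, x i ≤ v i} = Set.pi Set.univ fun i => Set.Iic (v i) := by
      ext x; simp [Pi.le_def]
    have h2 : Q.real {p | ∀ i, Z' i p ≤ v i} = γ.real {x : ι → ℝ | ∀ i, x i ≤ v i} := by
      refine hsnd.measureReal_preimage (s := {x : ι → ℝ | ∀ i, x i ≤ v i}) ?_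
      rw [h1]
      exact (MeasurableSet.univ_pi fun i => measurableSet_Iic).nullMeasurableSet
    rw [h2, h1, measureReal_def, Measure.pi_pi, ENNReal.toReal_prod]
    rfl
  rwa [eX, eZ] at key

end

/-- Berman's inequality for finitely many coordinates of a Gaussian process. -/
theorem ProbabilityTheory.IsGaussianProcess.abs_measureReal_sub_prod_le {T Ω : Type*}
    [DecidableEq T] [MeasurableSpace Ω] {P : Measure Ω} {X : T → Ω → ℝ}
    (hXm : ∀ i, Measurable (X i)) (hX : IsGaussianProcess X P)
    (hX0 : ∀ i, ∫ ω, X i ω ∂P = 0) (hX1 : ∀ i, Var[X i; P] = 1)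
    {δ u : ℝ} (hδ : δ < 1) (hu : 0 ≤ u) (s : Finset T) {v : T → ℝ} (hv : ∀ i, u ≤ v i)
    (hc : ∀ i j, i ≠ j → |cov[X i, X j; P]| ≤ δ) :
    |P.real {ω | ∀ i ∈ s, X i ω ≤ v i} - ∏ i ∈ s, (gaussianReal 0 1).real (Set.Iic (v i))| ≤
      Real.pi / 2 * ∑ i ∈ s, ∑ j ∈ s.erase i,
        |cov[X i, X j; P]| * comparisonWeight δ u |cov[X i, X j; P]| := by
  have key := _root_.abs_measureReal_sub_prod_le (ι := s) (X := fun i => X i) (P := P)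
    (fun i => hXm i) (hX.hasGaussianLaw s) (fun i => hX0 i) (fun i => hX1 i) hδ hu
    (v := fun i => v i) (fun i => hv i) (fun i j hij => hc i j fun h => hij (Subtype.ext h))
  have e1 : {ω | ∀ i : s, X i ω ≤ v i} = {ω | ∀ i ∈ s, X i ω ≤ v i} := by
    ext ω; simp
  have e2 : ∏ i : s, (gaussianReal 0 1).real (Set.Iic (v i)) =
      ∏ i ∈ s, (gaussianReal 0 1).real (Set.Iic (v i)) :=
    Finset.prod_coe_sort s fun i => (gaussianReal 0 1).real (Set.Iic (v i))
  let f : T → T → ℝ := fun i j => |cov[X i, X j; P]| * comparisonWeight δ u |cov[X i, X j; P]|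
  have e3 : ∑ i : s, ∑ j ∈ Finset.univ.erase i, f i j = ∑ i ∈ s, ∑ j ∈ s.erase i, f i j := by
    rw [← Finset.sum_coe_sort s]
    refine Finset.sum_congr rfl fun i _ => ?_
    have h1 := Finset.add_sum_erase (s := (Finset.univ : Finset s)) (fun j : s => f i j)
      (Finset.mem_univ i)
    have h2 := Finset.add_sum_erase (s := s) (fun j => f i j) i.2
    rw [← Finset.sum_coe_sort s] at h2
    linarith
  rw [e1, e2] at key
  exact key.trans_eq (by rw [← e3])

/-! ### Asymptotics of the Gaussian tail. -/

/-- The tail of the standard normal law. -/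
noncomputable def gaussianTail (u : ℝ) : ℝ := (gaussianReal 0 1).real (Set.Ioi u)

theorem measureReal_Iic_eq_one_sub_gaussianTail (u : ℝ) :
    (gaussianReal 0 1).real (Set.Iic u) = 1 - gaussianTail u := by
  have := probReal_compl_eq_one_sub (μ := gaussianReal 0 1) (measurableSet_Ioi (a := u))
  rwa [Set.compl_Ioi] at this

theorem gaussianTail_eq_integral (u : ℝ) :
    gaussianTail u = ∫ t in Set.Ioi u, gaussianPDFReal 0 1 t := by
  rw [gaussianTail, measureReal_def, gaussianReal_apply_eq_integral _ one_ne_zero,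
    ENNReal.toReal_ofReal]
  exact setIntegral_nonneg measurableSet_Ioi fun t _ => gaussianPDFReal_nonneg _ _ _

theorem gaussianPDFReal_zero_one (t : ℝ) :
    gaussianPDFReal 0 1 t = (√(2 * Real.pi))⁻¹ * Real.exp (-t ^ 2 / 2) := by
  simp [gaussianPDFReal]

/-- Mills' ratio bounds. -/
theorem gaussianTail_bounds {u : ℝ} (hu : 0 < u) :
    gaussianTail u ≤ gaussianPDFReal 0 1 u / u ∧
      gaussianPDFReal 0 1 u / u ≤ (1 + 1 / u ^ 2) * gaussianTail u := by
  have hint : IntegrableOn (gaussianPDFReal 0 1) (Set.Ioi u) :=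
    (integrable_gaussianPDFReal 0 1).integrableOn
  -- This explicit antiderivative gives both bounds, because 1 ≤ 1 + 1/t² ≤ 1 + 1/u² for t > u.
  have hder : ∀ t ∈ Set.Ici u, HasDerivAt (fun t => -(gaussianPDFReal 0 1 t / t))
      (gaussianPDFReal 0 1 t * (1 + 1 / t ^ 2)) t := by
    intro t ht
    have ht0 : t ≠ 0 := (hu.trans_le ht).ne'
    have h1 : HasDerivAt (fun t : ℝ => -t ^ 2 / 2) (-t) t := by
      refine (((hasDerivAt_id t).pow 2).neg.div_const 2).congr_deriv ?_
      simp; ring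
    have h2 : HasDerivAt (gaussianPDFReal 0 1) (-t * gaussianPDFReal 0 1 t) t := by
      have := h1.exp.const_mul (√(2 * Real.pi))⁻¹
      have e : gaussianPDFReal 0 1 = fun t => (√(2 * Real.pi))⁻¹ * Real.exp (-t ^ 2 / 2) :=
        funext gaussianPDFReal_zero_one
      rw [e]
      refine this.congr_deriv ?_
      ring
    refine ((h2.div (hasDerivAt_id t) ht0).neg).congr_deriv ?_
    simp only [id]
    field_simp
    ring
  have hpdf0 : Tendsto (fun t => -(gaussianPDFReal 0 1 t / t)) atTop (𝓝 0) := by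
    have hb : ∀ᶠ t : ℝ in atTop, ‖-(gaussianPDFReal 0 1 t / t)‖ ≤ (√(2 * Real.pi))⁻¹ * t⁻¹ := by
      filter_upwards [eventually_gt_atTop 0] with t ht
      rw [norm_neg, Real.norm_eq_abs, abs_of_nonneg
        (div_nonneg (gaussianPDFReal_nonneg _ _ _) ht.le), gaussianPDFReal_zero_one, div_eq_mul_inv]
      gcongr
      refine mul_le_of_le_one_right (by positivity) (Real.exp_le_one_iff.2 ?_)
      have := sq_nonneg t
      linarith
    refine squeeze_zero_norm' hb ?_
    simpa using tendsto_inv_atTop_zero.const_mul ((√(2 * Real.pi))⁻¹)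
  have hm : AEStronglyMeasurable (fun t : ℝ => 1 + 1 / t ^ 2) (volume.restrict (Set.Ioi u)) :=
    (by fun_prop : Measurable fun t : ℝ => 1 + 1 / t ^ 2).aestronglyMeasurable
  have hle : ∀ t ∈ Set.Ioi u, 1 / t ^ 2 ≤ 1 / u ^ 2 := fun t ht => by
    have := le_of_lt (Set.mem_Ioi.1 ht)
    gcongr
  have hint2 : IntegrableOn (fun t => gaussianPDFReal 0 1 t * (1 + 1 / t ^ 2)) (Set.Ioi u) := by
    refine Integrable.mul_bdd (c := 1 + 1 / u ^ 2) hint hm ?_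
    refine (ae_restrict_mem measurableSet_Ioi).mono fun t ht => ?_
    rw [Real.norm_eq_abs, abs_of_nonneg (by positivity)]
    linarith [hle t ht]
  have hval : ∫ t in Set.Ioi u, gaussianPDFReal 0 1 t * (1 + 1 / t ^ 2) =
      gaussianPDFReal 0 1 u / u := by
    rw [integral_Ioi_of_hasDerivAt_of_tendsto' hder hint2 hpdf0]
    ring
  rw [gaussianTail_eq_integral, ← hval]
  constructor
  · refine setIntegral_mono_on hint hint2 measurableSet_Ioi fun t _ => ?_
    refine le_mul_of_one_le_right (gaussianPDFReal_nonneg _ _ _) ?_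
    have : 0 ≤ 1 / t ^ 2 := by positivity
    linarith
  · rw [← integral_const_mul]
    refine setIntegral_mono_on hint2 (hint.const_mul _) measurableSet_Ioi fun t ht => ?_
    rw [mul_comm]
    exact mul_le_mul_of_nonneg_right (by linarith [hle t ht]) (gaussianPDFReal_nonneg _ _ _)

theorem tendsto_gaussianTail_mul_div :
    Tendsto (fun u => gaussianTail u * (u / gaussianPDFReal 0 1 u)) atTop (𝓝 1) := by
  have hlow : Tendsto (fun u : ℝ => (1 + 1 / u ^ 2)⁻¹) atTop (𝓝 1) := by
    have h : Tendsto (fun u : ℝ => 1 / u ^ 2) atTop (𝓝 0) := by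
      simp only [one_div]
      exact (tendsto_pow_atTop (α := ℝ) two_ne_zero).inv_tendsto_atTop
    have := (h.const_add 1).inv₀ (by norm_num)
    simpa using this
  refine tendsto_of_tendsto_of_tendsto_of_le_of_le' hlow tendsto_const_nhds ?_ ?_
  · filter_upwards [eventually_gt_atTop 0] with u hu
    have hp := gaussianPDFReal_pos 0 1 u one_ne_zero
    have h := (gaussianTail_bounds hu).2
    rw [div_le_iff₀ hu] at h
    rw [inv_le_iff_one_le_mul₀ (by positivity)]
    have e : gaussianTail u * (u / gaussianPDFReal 0 1 u) * (1 + 1 / u ^ 2) =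
        (1 + 1 / u ^ 2) * gaussianTail u * u / gaussianPDFReal 0 1 u := by ring
    rw [e, le_div_iff₀ hp]
    linarith
  · filter_upwards [eventually_gt_atTop 0] with u hu
    have hp := gaussianPDFReal_pos 0 1 u one_ne_zero
    have h := (gaussianTail_bounds hu).1
    rw [le_div_iff₀ hu] at h
    rw [← mul_div_assoc, div_le_one hp]
    exact h

/-! ### The Gumbel normalization. -/

/-- The level `a_n⁻¹ x + b_n`. -/
noncomputable def gumbelLevel (x : ℝ) (n : ℕ) : ℝ := (gumbelA n)⁻¹ * x + gumbelB n

/-- The second order term of `gumbelLevel`. -/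
noncomputable def gumbelShift (x L : ℝ) : ℝ := x - (Real.log L + Real.log (4 * Real.pi)) / 2

theorem gumbelLevel_eq (x : ℝ) (n : ℕ) :
    gumbelLevel x n = gumbelA n + gumbelShift x (Real.log n) / gumbelA n := by
  rw [gumbelLevel, gumbelB, gumbelShift]
  ring

theorem tendsto_log_natCast : Tendsto (fun n : ℕ => Real.log n) atTop atTop :=
  Real.tendsto_log_atTop.comp tendsto_natCast_atTop_atTop

theorem tendsto_gumbelA : Tendsto gumbelA atTop atTop :=
  Real.tendsto_sqrt_atTop.comp (tendsto_log_natCast.const_mul_atTop two_pos)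

theorem sq_gumbelA {n : ℕ} (hn : 0 ≤ Real.log n) : gumbelA n ^ 2 = 2 * Real.log n :=
  Real.sq_sqrt (mul_nonneg zero_le_two hn)

theorem tendsto_gumbelShift_div (x : ℝ) :
    Tendsto (fun n : ℕ => gumbelShift x (Real.log n) / gumbelA n) atTop (𝓝 0) := by
  have h1 : Tendsto (fun L : ℝ => Real.log L / √(2 * L)) atTop (𝓝 0) := by
    have h := (isLittleO_log_rpow_atTop (r := 1 / 2) (by norm_num)).tendsto_div_nhds_zero
    have h' := h.mul_const (√2)⁻¹
    rw [zero_mul] at h'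
    refine h'.congr fun L => ?_
    rw [Real.sqrt_mul zero_le_two, ← Real.sqrt_eq_rpow]
    field_simp
  have h2 := h1.comp tendsto_log_natCast
  have h3 : Tendsto (fun n : ℕ => (x - Real.log (4 * Real.pi) / 2) * (gumbelA n)⁻¹) atTop
      (𝓝 0) := by
    simpa using tendsto_gumbelA.inv_tendsto_atTop.const_mul (x - Real.log (4 * Real.pi) / 2)
  have h4 := h3.sub (h2.div_const 2)
  simp only [zero_div, sub_zero] at h4
  refine h4.congr fun n => ?_
  simp only [Function.comp_apply, gumbelShift, gumbelA]
  ring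

theorem tendsto_gumbelLevel_div (x : ℝ) :
    Tendsto (fun n : ℕ => gumbelLevel x n / gumbelA n) atTop (𝓝 1) := by
  have h := ((tendsto_gumbelShift_div x).mul tendsto_gumbelA.inv_tendsto_atTop).const_add 1
  simp only [mul_zero, add_zero] at h
  refine h.congr' ?_
  filter_upwards [tendsto_gumbelA.eventually_gt_atTop 0] with n hn
  rw [gumbelLevel_eq, add_div, div_self hn.ne', Pi.inv_apply]
  ring

theorem tendsto_gumbelLevel (x : ℝ) : Tendsto (gumbelLevel x) atTop atTop := by
  refine ((tendsto_gumbelLevel_div x).pos_mul_atTop one_pos tendsto_gumbelA).congr' ?_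
  filter_upwards [tendsto_gumbelA.eventually_gt_atTop 0] with n hn
  field_simp

/-- Squaring a_n + shift/a_n gives 2 log n + 2 shift + (shift/a_n)². The logarithmic terms of b_n
are exactly those making exp(-shift) = √(2π) a_n e^{-x}, which cancels the prefactor in Mills' ratio
asymptotically. -/
theorem exp_neg_sq_gumbelLevel (x : ℝ) {n : ℕ} (hn : 0 < Real.log n) :
    Real.exp (-gumbelLevel x n ^ 2 / 2) =
      (n : ℝ)⁻¹ * (√(2 * Real.pi) * gumbelA n) * Real.exp (-x) *
        Real.exp (-(gumbelShift x (Real.log n) / gumbelA n) ^ 2 / 2) := by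
  have hA : 0 < gumbelA n := Real.sqrt_pos.2 (by positivity)
  have hn0 : (0 : ℝ) < n := by
    rcases Nat.eq_zero_or_pos n with rfl | h
    · simp at hn
    · exact_mod_cast h
  have e1 : √(2 * Real.pi) * gumbelA n =
      Real.exp ((Real.log (Real.log n) + Real.log (4 * Real.pi)) / 2) := by
    rw [gumbelA, ← Real.sqrt_mul (by positivity), ← Real.log_mul hn.ne' (by positivity),
      Real.exp_half, Real.exp_log (by positivity)]
    congr 1
    ring
  have e2 : (n : ℝ)⁻¹ = Real.exp (-Real.log n) := by rw [Real.exp_neg, Real.exp_log hn0]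
  rw [e1, e2, ← Real.exp_add, ← Real.exp_add, ← Real.exp_add]
  congr 1
  have e3 : gumbelLevel x n ^ 2 = gumbelA n ^ 2 + 2 * gumbelShift x (Real.log n) +
      (gumbelShift x (Real.log n) / gumbelA n) ^ 2 := by
    rw [gumbelLevel_eq]
    field_simp
    ring
  rw [e3, sq_gumbelA hn.le, gumbelShift]
  ring

theorem exp_neg_sq_gumbelLevel_le (x : ℝ) {n : ℕ} (hn : 0 < Real.log n) :
    Real.exp (-gumbelLevel x n ^ 2) ≤
      4 * Real.pi * Real.exp (-x) ^ 2 * (Real.log n / (n : ℝ) ^ 2) := by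
  have h : Real.exp (-gumbelLevel x n ^ 2 / 2) ≤
      (n : ℝ)⁻¹ * (√(2 * Real.pi) * gumbelA n) * Real.exp (-x) := by
    rw [exp_neg_sq_gumbelLevel x hn]
    have hA : 0 ≤ gumbelA n := Real.sqrt_nonneg _
    refine mul_le_of_le_one_right (by positivity) (Real.exp_le_one_iff.2 ?_)
    have := sq_nonneg (gumbelShift x (Real.log n) / gumbelA n)
    linarith
  have h2 := pow_le_pow_left₀ (Real.exp_pos _).le h 2
  have e : Real.exp (-gumbelLevel x n ^ 2 / 2) ^ 2 = Real.exp (-gumbelLevel x n ^ 2) := by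
    rw [← Real.exp_nat_mul]; congr 1; push_cast; ring
  rw [e, mul_pow, mul_pow, mul_pow, Real.sq_sqrt (by positivity), sq_gumbelA hn.le] at h2
  refine h2.trans_eq ?_
  rw [inv_pow]
  ring

theorem tendsto_nat_mul_gaussianTail (x : ℝ) :
    Tendsto (fun n : ℕ => (n : ℝ) * gaussianTail (gumbelLevel x n)) atTop (𝓝 (Real.exp (-x))) := by
  have h1 := tendsto_gaussianTail_mul_div.comp (tendsto_gumbelLevel x)
  have h2 : Tendsto (fun n : ℕ => (n : ℝ) * gaussianPDFReal 0 1 (gumbelLevel x n) /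
      gumbelLevel x n) atTop (𝓝 (Real.exp (-x))) := by
    have h3 : Tendsto (fun n : ℕ => Real.exp (-x) * (gumbelLevel x n / gumbelA n)⁻¹ *
        Real.exp (-(gumbelShift x (Real.log n) / gumbelA n) ^ 2 / 2)) atTop
        (𝓝 (Real.exp (-x) * 1⁻¹ * Real.exp (-(0 : ℝ) ^ 2 / 2))) :=
      (((tendsto_gumbelLevel_div x).inv₀ one_ne_zero).const_mul _).mul
        ((Real.continuous_exp.tendsto _).comp
          ((((tendsto_gumbelShift_div x).pow 2).neg).div_const 2))
    simp only [inv_one, mul_one, ne_eq, OfNat.ofNat_ne_zero, not_false_eq_true, zero_pow, neg_zero,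
      zero_div, Real.exp_zero] at h3
    refine h3.congr' ?_
    filter_upwards [tendsto_log_natCast.eventually_gt_atTop 0, eventually_gt_atTop 0,
      tendsto_gumbelA.eventually_gt_atTop 0] with n hn hn0 hA
    have hn0' : (n : ℝ) ≠ 0 := by positivity
    have hpi : √(2 * Real.pi) ≠ 0 := by positivity
    rw [gaussianPDFReal_zero_one, exp_neg_sq_gumbelLevel x hn]
    generalize Real.exp (-(gumbelShift x (Real.log n) / gumbelA n) ^ 2 / 2) = e
    rw [inv_div]
    generalize √(2 * Real.pi) = q at *
    field_simp
  have h3 := h1.mul h2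
  rw [one_mul] at h3
  refine h3.congr' ?_
  filter_upwards [(tendsto_gumbelLevel x).eventually_gt_atTop 0] with n hn
  have hp := gaussianPDFReal_pos 0 1 (gumbelLevel x n) one_ne_zero
  simp only [Function.comp_apply]
  field_simp

/-- The logarithmic form of Φ(u_n)^n → exp(-e^{-x}), suited to the random exponent n - S_n. -/
theorem tendsto_nat_mul_log_measureReal_Iic (x : ℝ) :
    Tendsto (fun n : ℕ => (n : ℝ) * Real.log ((gaussianReal 0 1).real
      (Set.Iic (gumbelLevel x n)))) atTop (𝓝 (-Real.exp (-x))) := by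
  have h := Real.tendsto_nat_mul_log_one_add_of_tendsto
    (g := fun n => -gaussianTail (gumbelLevel x n)) (t := -Real.exp (-x))
    (by simpa using (tendsto_nat_mul_gaussianTail x).neg)
  refine h.congr fun n => ?_
  rw [measureReal_Iic_eq_one_sub_gaussianTail, sub_eq_add_neg]

theorem eventually_sq_gumbelLevel_le (x : ℝ) :
    ∀ᶠ n : ℕ in atTop, gumbelLevel x n ^ 2 ≤ 3 * Real.log n := by
  have h := (tendsto_gumbelLevel_div x).pow 2
  filter_upwards [h.eventually_le_const (u := 3 / 2) (by norm_num),
    tendsto_log_natCast.eventually_gt_atTop 0] with n h1 hn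
  rw [div_pow, sq_gumbelA hn.le, div_le_iff₀ (by positivity)] at h1
  linarith

/-! ### Vanishing of the comparison error. -/

/-- Berman's condition makes the normal comparison bound vanish. -/
theorem tendsto_nat_mul_sum_berman {r u : ℕ → ℝ} {δ K : ℝ} (hδ0 : 0 ≤ δ) (hδ : δ < 1)
    (hr : ∀ k, k ≠ 0 → |r k| ≤ δ) (hlog : Tendsto (fun k : ℕ => r k * Real.log k) atTop (𝓝 0))
    (hK : 0 ≤ K) (hu : ∀ᶠ n in atTop, Real.exp (-u n ^ 2) ≤ K * (Real.log n / (n : ℝ) ^ 2))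
    (hu3 : ∀ᶠ n in atTop, u n ^ 2 ≤ 3 * Real.log n) :
    Tendsto (fun n : ℕ => (n : ℝ) * ∑ k ∈ Finset.Ico 1 n,
      |r k| * Real.exp (-u n ^ 2 / (1 + |r k|))) atTop (𝓝 0) := by
  set p : ℝ := 1 / (1 + δ) with hp
  -- With this α, n^(1+α) n^(-2p) = n^(-α): lags up to n^α are negligible under the crude bound |r|
  -- ≤ δ. Positivity of α is where δ < 1 enters.
  set α : ℝ := (2 * p - 1) / 2 with hα
  have hp0 : 0 < p := by positivity
  have hα0 : 0 < α := by
    have : 1 / 2 < p := by rw [hp]; apply one_div_lt_one_div_of_lt <;> linarith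
    rw [hα]; linarith
  have hpow : Tendsto (fun n : ℕ => (n : ℝ) ^ α) atTop atTop :=
    (tendsto_rpow_atTop hα0).comp tendsto_natCast_atTop_atTop
  have hT1 : Tendsto (fun n : ℕ => (n : ℝ) * (n : ℝ) ^ α * (K * (Real.log n / (n : ℝ) ^ 2)) ^ p)
      atTop (𝓝 0) := by
    have h := ((isLittleO_log_rpow_rpow_atTop p hα0).tendsto_div_nhds_zero).comp
      tendsto_natCast_atTop_atTop
    have h' := h.const_mul (K ^ p)
    rw [mul_zero] at h'
    refine h'.congr' ?_
    filter_upwards [eventually_gt_atTop 0, tendsto_log_natCast.eventually_gt_atTop 0] with n hn hl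
    have hn' : (0 : ℝ) < n := by exact_mod_cast hn
    simp only [Function.comp_apply]
    rw [Real.mul_rpow hK (by positivity), Real.div_rpow hl.le (by positivity),
      ← Real.rpow_natCast (n : ℝ) 2, ← Real.rpow_mul hn'.le]
    have e : (n : ℝ) ^ (((2 : ℕ) : ℝ) * p) = (n : ℝ) * (n : ℝ) ^ α * (n : ℝ) ^ α := by
      conv_rhs => rw [← Real.rpow_one_add' hn'.le (by linarith), ← Real.rpow_add hn']
      congr 1
      rw [hα]; push_cast; ring
    rw [e]
    have : (n : ℝ) ^ α ≠ 0 := (Real.rpow_pos_of_pos hn' _).ne'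
    field_simp
  rw [Metric.tendsto_atTop']
  intro ε hε
  -- The bound η ≤ α keeps u²|r| ≤ 3 at lags beyond n^α; the last condition makes their total
  -- contribution less than ε/2.
  obtain ⟨η, hη0, hηα, hηε⟩ : ∃ η, 0 < η ∧ η ≤ α ∧ η * (K / α * Real.exp 3) < ε / 2 := by
    have hc : 0 ≤ K / α * Real.exp 3 := by positivity
    refine ⟨min α (ε / 4 / (K / α * Real.exp 3 + 1)), lt_min hα0 (by positivity),
      min_le_left _ _, ?_⟩
    calc _ ≤ ε / 4 / (K / α * Real.exp 3 + 1) * (K / α * Real.exp 3 + 1) :=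
          mul_le_mul (min_le_right _ _) (by linarith) hc (by positivity)
      _ = ε / 4 := by field_simp
      _ < _ := by linarith
  obtain ⟨N₀, hN₀⟩ := (Metric.tendsto_atTop'.1 hlog) η hη0
  have hev : ∀ᶠ n : ℕ in atTop, (n : ℝ) * ∑ k ∈ Finset.Ico 1 n,
      |r k| * Real.exp (-u n ^ 2 / (1 + |r k|)) < ε := by
    filter_upwards [hu, hu3, hT1.eventually_lt_const (half_pos hε),
      hpow.eventually_gt_atTop (N₀ : ℝ), eventually_gt_atTop 0,
      tendsto_log_natCast.eventually_gt_atTop 0] with n h1 h3 hT hN hn hl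
    have hn' : (0 : ℝ) < n := by exact_mod_cast hn
    set E := K * (Real.log n / (n : ℝ) ^ 2) with hE
    have hE0 : 0 ≤ E := by positivity
    have hpn : 0 < (n : ℝ) ^ α := Real.rpow_pos_of_pos hn' _
    have hsmall : ∀ k ∈ (Finset.Ico 1 n).filter (fun k : ℕ => (k : ℝ) ≤ (n : ℝ) ^ α),
        |r k| * Real.exp (-u n ^ 2 / (1 + |r k|)) ≤ E ^ p := by
      intro k hk
      have hk1 : k ≠ 0 := by
        have := (Finset.mem_Ico.1 (Finset.mem_filter.1 hk).1).1
        omega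
      have hrk := hr k hk1
      have ha := abs_nonneg (r k)
      refine (mul_le_of_le_one_left (Real.exp_pos _).le (by linarith)).trans ?_
      calc Real.exp (-u n ^ 2 / (1 + |r k|)) ≤ Real.exp (-u n ^ 2 * p) := by
            apply Real.exp_le_exp.2
            rw [neg_div, neg_mul, hp, mul_one_div]
            apply neg_le_neg
            gcongr
        _ = Real.exp (-u n ^ 2) ^ p := by rw [Real.exp_mul]
        _ ≤ E ^ p := Real.rpow_le_rpow (Real.exp_pos _).le h1 hp0.le
    -- Beyond n^α, log k ≥ α log n, so |r k| ≤ η/(α log n): correlation costs only a factor e³ in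
    -- the exponential, and the log n in E cancels.
    have hlarge : ∀ k ∈ (Finset.Ico 1 n).filter (fun k : ℕ => ¬ (k : ℝ) ≤ (n : ℝ) ^ α),
        |r k| * Real.exp (-u n ^ 2 / (1 + |r k|)) ≤
          η / (α * Real.log n) * (E * Real.exp 3) := by
      intro k hk
      have hk2 := not_le.1 (Finset.mem_filter.1 hk).2
      have hkN : N₀ < k := by exact_mod_cast hN.trans hk2
      have hk0 : (0 : ℝ) < k := hpn.trans hk2
      have hlk : α * Real.log n ≤ Real.log k := by
        rw [← Real.log_rpow hn']
        exact Real.log_le_log hpn hk2.le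
      have hαl : 0 < α * Real.log n := by positivity
      have hrk : |r k| ≤ η / (α * Real.log n) := by
        have := hN₀ k hkN
        rw [Real.dist_eq, sub_zero, abs_mul, abs_of_pos (hαl.trans_le hlk)] at this
        rw [le_div_iff₀ hαl]
        exact (mul_le_mul_of_nonneg_left hlk (abs_nonneg _)).trans this.le
      have ha := abs_nonneg (r k)
      refine mul_le_mul hrk ?_ (Real.exp_pos _).le (by positivity)
      calc Real.exp (-u n ^ 2 / (1 + |r k|)) ≤ Real.exp (-u n ^ 2 + 3) := by
            apply Real.exp_le_exp.2
            rw [div_le_iff₀ (by positivity)]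
            have h4 : u n ^ 2 * |r k| ≤ 3 := by
              calc u n ^ 2 * |r k| ≤ 3 * Real.log n * (η / (α * Real.log n)) :=
                    mul_le_mul h3 hrk ha (by positivity)
                _ = 3 * (η / α) := by field_simp
                _ ≤ 3 * 1 := by gcongr; exact (div_le_one hα0).2 hηα
                _ = 3 := by norm_num
            nlinarith
        _ = Real.exp (-u n ^ 2) * Real.exp 3 := Real.exp_add _ _
        _ ≤ E * Real.exp 3 := by gcongr
    have hcard : (((Finset.Ico 1 n).filter (fun k : ℕ => (k : ℝ) ≤ (n : ℝ) ^ α)).card : ℝ) ≤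
        (n : ℝ) ^ α := by
      have hsub : (Finset.Ico 1 n).filter (fun k : ℕ => (k : ℝ) ≤ (n : ℝ) ^ α) ⊆
          Finset.Icc 1 ⌊(n : ℝ) ^ α⌋₊ := by
        intro k hk
        rw [Finset.mem_filter, Finset.mem_Ico] at hk
        exact Finset.mem_Icc.2 ⟨hk.1.1, Nat.le_floor hk.2⟩
      have := Finset.card_le_card hsub
      rw [Nat.card_Icc, Nat.add_sub_cancel] at this
      exact (Nat.cast_le.2 this).trans (Nat.floor_le hpn.le)
    have hcard2 : (((Finset.Ico 1 n).filter (fun k : ℕ => ¬ (k : ℝ) ≤ (n : ℝ) ^ α)).card : ℝ) ≤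
        n := by
      have := (Finset.card_filter_le (Finset.Ico 1 n) (fun k : ℕ => ¬ (k : ℝ) ≤ (n : ℝ) ^ α))
      rw [Nat.card_Ico] at this
      exact_mod_cast this.trans (Nat.sub_le n 1)
    have hs1 := Finset.sum_le_card_nsmul _ _ _ hsmall
    have hs2 := Finset.sum_le_card_nsmul _ _ _ hlarge
    rw [nsmul_eq_mul] at hs1 hs2
    rw [← Finset.sum_filter_add_sum_filter_not _ (fun k : ℕ => (k : ℝ) ≤ (n : ℝ) ^ α)]
    calc _ ≤ (n : ℝ) * ((n : ℝ) ^ α * E ^ p + n * (η / (α * Real.log n) * (E * Real.exp 3))) := by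
          gcongr
          · exact hs1.trans (by gcongr)
          · exact hs2.trans (by gcongr)
      _ = (n : ℝ) * (n : ℝ) ^ α * E ^ p + η * (K / α * Real.exp 3) := by
          rw [mul_add, hE]
          congr 1
          · ring
          · field_simp
      _ < ε := by linarith
  obtain ⟨N, hN⟩ := eventually_atTop.1 hev
  refine ⟨N, fun n hn => ?_⟩
  rw [Real.dist_eq, sub_zero, abs_of_nonneg]
  · exact hN n (le_of_lt hn)
  · positivity

/-- Sums over pairs of a function of the distance of the indices. -/
theorem sum_sum_erase_dist_le {g : ℕ → ℝ} (hg : ∀ k, 0 ≤ g k) {n : ℕ} {s : Finset ℕ}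
    (hs : s ⊆ Finset.range n) :
    ∑ i ∈ s, ∑ j ∈ s.erase i, g (Nat.dist i j) ≤ 2 * (n * ∑ k ∈ Finset.Ico 1 n, g k) := by
  have hin : ∀ i ∈ s, ∑ j ∈ s.erase i, g (Nat.dist i j) ≤ 2 * ∑ k ∈ Finset.Ico 1 n, g k := by
    intro i hi
    have hi' := Finset.mem_range.1 (hs hi)
    have hmaps : ∀ j ∈ s.erase i, Nat.dist i j ∈ Finset.Ico 1 n := by
      intro j hj
      have hj1 := Finset.ne_of_mem_erase hj
      have hj2 := Finset.mem_range.1 (hs (Finset.mem_of_mem_erase hj))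
      rw [Finset.mem_Ico, Nat.dist]
      omega
    rw [← Finset.sum_fiberwise_of_maps_to hmaps, Finset.mul_sum]
    refine Finset.sum_le_sum fun k _ => ?_
    -- At most two indices lie at distance k from i; truncation of i - k is harmless for an
    -- inclusion.
    have hsub : (s.erase i).filter (fun j => Nat.dist i j = k) ⊆ {i + k, i - k} := by
      intro j hj
      have := (Finset.mem_filter.1 hj).2
      rw [Nat.dist] at this
      rw [Finset.mem_insert, Finset.mem_singleton]
      omega
    have hcard := (Finset.card_le_card hsub).trans Finset.card_le_two
    rw [Finset.sum_congr rfl (g := fun _ => g k) fun j hj => by rw [(Finset.mem_filter.1 hj).2],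
      Finset.sum_const, nsmul_eq_mul]
    exact mul_le_mul_of_nonneg_right (by exact_mod_cast hcard) (hg k)
  have hsum := Finset.sum_le_card_nsmul _ _ _ hin
  rw [nsmul_eq_mul] at hsum
  have hc : (s.card : ℝ) ≤ n := by
    have := Finset.card_le_card hs
    rw [Finset.card_range] at this
    exact_mod_cast this
  have h0 : 0 ≤ ∑ k ∈ Finset.Ico 1 n, g k := Finset.sum_nonneg fun k _ => hg k
  calc _ ≤ (s.card : ℝ) * (2 * ∑ k ∈ Finset.Ico 1 n, g k) := hsum
    _ ≤ n * (2 * ∑ k ∈ Finset.Ico 1 n, g k) := by gcongr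
    _ = _ := by ring

/-! ### Correlations of a stationary Gaussian sequence. -/

section Covariance

variable {Ω : Type*} [MeasurableSpace Ω] {P : Measure Ω}

theorem covariance_eq_of_identDistrib {X X' : ℕ → Ω → ℝ} (hX : ∀ n, Measurable (X n))
    (hX' : ∀ n, Measurable (X' n))
    (h : IdentDistrib (fun ω n => X n ω) (fun ω n => X' n ω) P P) (i j : ℕ) :
    cov[X i, X j; P] = cov[X' i, X' j; P] := by
  have key : ∀ Z : ℕ → Ω → ℝ, (∀ n, Measurable (Z n)) → cov[Z i, Z j; P] =
      cov[fun f : ℕ → ℝ => f i, fun f => f j; P.map fun ω n => Z n ω] := by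
    intro Z hZ
    rw [covariance_map (measurable_pi_apply i).aestronglyMeasurable
      (measurable_pi_apply j).aestronglyMeasurable (measurable_pi_lambda _ hZ).aemeasurable]
    rfl
  rw [key X hX, key X' hX', h.map_eq]

theorem covariance_eq_zero_of_variance_eq_zero [IsProbabilityMeasure P] {X D : Ω → ℝ} (hX : MemLp X 2 P) (hD : MemLp D 2 P)
    (h0 : Var[D; P] = 0) : cov[X, D; P] = 0 := by
  by_contra hc
  set c := cov[X, D; P]
  -- The variance of X + tD is affine in t when Var D = 0; this t would make it equal to -1.
  have h := variance_nonneg (fun ω => X ω + (-(Var[X; P] + 1) / (2 * c)) * D ω) P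
  rw [variance_fun_add hX (hD.const_mul _), covariance_const_mul_right, variance_const_mul, h0]
    at h
  have e : 2 * (-(Var[X; P] + 1) / (2 * c) * c) = -(Var[X; P] + 1) := by field_simp
  change 0 ≤ _ + 2 * (_ * c) + _ at h
  rw [e] at h
  linarith

theorem abs_covariance_le_one [IsProbabilityMeasure P] {X X' : Ω → ℝ} (hX : MemLp X 2 P) (hX' : MemLp X' 2 P)
    (h1 : Var[X; P] = 1) (h1' : Var[X'; P] = 1) : |cov[X, X'; P]| ≤ 1 := by
  have hp := variance_nonneg (fun ω => X ω + X' ω) P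
  have hm := variance_nonneg (fun ω => X ω - X' ω) P
  rw [variance_fun_add hX hX', h1, h1'] at hp
  rw [variance_fun_sub hX hX', h1, h1'] at hm
  exact abs_le.2 ⟨by linarith, by linarith⟩

end Covariance

namespace IsStandardStationaryGaussian

variable {Ω : Type*} [MeasurableSpace Ω] {P : Measure Ω}
  {Y Y' : ℕ → Ω → ℝ}

theorem memLp (hY : IsStandardStationaryGaussian P Y) (n : ℕ) : MemLp (Y n) 2 P :=
  (hY.gaussian.hasGaussianLaw_eval n).memLp_two

theorem covariance_eq_dist [IsProbabilityMeasure P] (hY : IsStandardStationaryGaussian P Y) (hYm : ∀ n, Measurable (Y n))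
    (i j : ℕ) : cov[Y i, Y j; P] = cov[Y 0, Y (Nat.dist i j); P] := by
  have key : ∀ m k, cov[Y m, Y (m + k); P] = cov[Y 0, Y k; P] := by
    intro m k
    have := covariance_eq_of_identDistrib (X := fun n => Y (n + m)) (fun n => hYm _) hYm
      (hY.stationary m) 0 k
    rwa [zero_add, add_comm k m] at this
  rcases le_total i j with h | h
  · obtain ⟨k, rfl⟩ := Nat.exists_eq_add_of_le h
    rw [key, Nat.dist_eq_sub_of_le h, Nat.add_sub_cancel_left]
  · obtain ⟨k, rfl⟩ := Nat.exists_eq_add_of_le h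
    rw [covariance_comm, key, Nat.dist_eq_sub_of_le_right h, Nat.add_sub_cancel_left]

theorem tendsto_covariance
    (hr : Tendsto (fun n : ℕ => cov[Y 0, Y n; P] * Real.log n) atTop (𝓝 0)) :
    Tendsto (fun n => cov[Y 0, Y n; P]) atTop (𝓝 0) := by
  have h := hr.mul tendsto_log_natCast.inv_tendsto_atTop
  rw [zero_mul] at h
  refine h.congr' ?_
  filter_upwards [tendsto_log_natCast.eventually_gt_atTop 0] with n hn
  simp only [Pi.inv_apply]
  field_simp

/-- If |r_k| = 1, then Y_{m+k} - r_k Y_m has variance zero for all m, so |r_{mk}| = 1 along all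
multiples of k, contradicting r → 0. -/
theorem abs_covariance_lt_one [IsProbabilityMeasure P] (hY : IsStandardStationaryGaussian P Y)
    (hYm : ∀ n, Measurable (Y n)) (hr : Tendsto (fun n => cov[Y 0, Y n; P]) atTop (𝓝 0))
    {k : ℕ} (hk : k ≠ 0) : |cov[Y 0, Y k; P]| < 1 := by
  refine lt_of_le_of_ne (abs_covariance_le_one (hY.memLp 0) (hY.memLp k) (hY.variance_one 0)
    (hY.variance_one k)) fun h1 => ?_
  set s := cov[Y 0, Y k; P] with hs
  have hs2 : s ^ 2 = 1 := by rw [← sq_abs, h1, one_pow]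
  have hstep : ∀ m, cov[Y 0, Y (m + k); P] = s * cov[Y 0, Y m; P] := by
    intro m
    have hD : Var[fun ω => Y (m + k) ω - s * Y m ω; P] = 0 := by
      rw [variance_fun_sub (hY.memLp _) ((hY.memLp _).const_mul _), variance_const_mul,
        covariance_const_mul_right, hY.variance_one, hY.variance_one, hY.covariance_eq_dist hYm,
        Nat.dist_eq_sub_of_le_right (Nat.le_add_right m k), Nat.add_sub_cancel_left, ← hs]
      linear_combination -hs2
    have h := covariance_eq_zero_of_variance_eq_zero (hY.memLp 0)
      ((hY.memLp _).sub ((hY.memLp _).const_mul _)) hD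
    rw [covariance_sub_right (hY.memLp 0) (hY.memLp _) ((hY.memLp _).const_mul _),
      covariance_const_mul_right] at h
    linarith
  have hmul : ∀ m : ℕ, |cov[Y 0, Y (m * k); P]| = 1 := by
    intro m
    induction m with
    | zero => rw [zero_mul, covariance_self (hYm 0).aemeasurable, hY.variance_one, abs_one]
    | succ m ih => rw [add_mul, one_mul, hstep, abs_mul, ih, h1, one_mul]
  have hsub : Tendsto (fun m : ℕ => m * k) atTop atTop :=
    tendsto_id.atTop_mul_const' (Nat.pos_of_ne_zero hk)
  have := (hr.comp hsub).abs
  simp only [Function.comp_def, hmul, abs_zero] at this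
  exact one_ne_zero (tendsto_nhds_unique tendsto_const_nhds this)

theorem exists_abs_covariance_le [IsProbabilityMeasure P] (hY : IsStandardStationaryGaussian P Y)
    (hYm : ∀ n, Measurable (Y n)) (hr : Tendsto (fun n => cov[Y 0, Y n; P]) atTop (𝓝 0)) :
    ∃ δ, 0 ≤ δ ∧ δ < 1 ∧ ∀ k, k ≠ 0 → |cov[Y 0, Y k; P]| ≤ δ := by
  have hr' := hr.abs
  rw [abs_zero] at hr'
  obtain ⟨N, hN⟩ := eventually_atTop.1 (hr'.eventually_le_const (u := 1 / 2) (by norm_num))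
  -- The value 1/2 covers all lags from N on and keeps the set nonempty.
  let S : Finset ℝ := insert (1 / 2) ((Finset.Ico 1 N).image fun k => |cov[Y 0, Y k; P]|)
  have hS : S.Nonempty := Finset.insert_nonempty _ _
  have hhalf : 1 / 2 ≤ S.max' hS := S.le_max' _ (Finset.mem_insert_self _ _)
  refine ⟨S.max' hS, by linarith, (Finset.max'_lt_iff _ hS).2 fun a ha => ?_, fun k hk => ?_⟩
  · rcases Finset.mem_insert.1 ha with rfl | ha
    · norm_num
    · obtain ⟨k, hk, rfl⟩ := Finset.mem_image.1 ha
      exact hY.abs_covariance_lt_one hYm hr (by have := (Finset.mem_Ico.1 hk).1; omega)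
  · rcases lt_or_ge k N with h | h
    · exact S.le_max' _ (Finset.mem_insert_of_mem
        (Finset.mem_image_of_mem _ (Finset.mem_Ico.2 ⟨Nat.pos_of_ne_zero hk, h⟩)))
    · exact (hN k h).trans hhalf

/-- A sequence with the same law as a standard stationary Gaussian sequence is one. -/
theorem of_identDistrib (hY : IsStandardStationaryGaussian P Y)
    (h : IdentDistrib (fun ω n => Y' n ω) (fun ω n => Y n ω) P P) :
    IsStandardStationaryGaussian P Y' where
  gaussian := by
    refine ⟨fun I => ⟨?_⟩⟩
    have hI := h.comp (u := fun f : ℕ → ℝ => I.restrict f) (Finset.measurable_restrict I)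
    have e : P.map (fun ω => I.restrict (Y' · ω)) = P.map (fun ω => I.restrict (Y · ω)) :=
      hI.map_eq
    rw [e]
    exact (hY.gaussian.hasGaussianLaw I).isGaussian_map
  stationary k := by
    have hshift : Measurable fun (f : ℕ → ℝ) n => f (n + k) :=
      measurable_pi_lambda _ fun n => measurable_pi_apply _
    exact (h.comp hshift).trans ((hY.stationary k).trans h.symm)
  mean_zero n := by
    rw [← hY.mean_zero n]
    exact (h.comp (measurable_pi_apply n)).integral_eq
  variance_one n := by
    rw [← hY.variance_one n]
    exact (h.comp (measurable_pi_apply n)).variance_eq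

/-- The probability that the observations with index in `s` stay below levels above `u` is close
to its value for independent observations, uniformly in `s`. -/
theorem abs_measureReal_sub_prod_le [IsProbabilityMeasure P] (hY : IsStandardStationaryGaussian P Y)
    (hYm : ∀ n, Measurable (Y n)) {δ u : ℝ} (hδ : δ < 1)
    (hc : ∀ k, k ≠ 0 → |cov[Y 0, Y k; P]| ≤ δ) (hu : 0 ≤ u) {n : ℕ} {s : Finset ℕ}
    (hs : s ⊆ Finset.range n) {v : ℕ → ℝ} (hv : ∀ i, u ≤ v i) :
    |P.real {ω | ∀ i ∈ s, Y i ω ≤ v i} - ∏ i ∈ s, (gaussianReal 0 1).real (Set.Iic (v i))| ≤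
      (2 * √(1 - δ ^ 2))⁻¹ * (n * ∑ k ∈ Finset.Ico 1 n, |cov[Y 0, Y k; P]| *
        Real.exp (-u ^ 2 / (1 + |cov[Y 0, Y k; P]|))) := by
  have hdist : ∀ i j, i ≠ j → Nat.dist i j ≠ 0 := fun i j hij h => hij (Nat.eq_of_dist_eq_zero h)
  have h := IsGaussianProcess.abs_measureReal_sub_prod_le hYm hY.gaussian hY.mean_zero
    hY.variance_one hδ hu s hv fun i j hij => by
      rw [hY.covariance_eq_dist hYm]; exact hc _ (hdist i j hij)
  refine h.trans ?_
  have hsum := sum_sum_erase_dist_le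
    (g := fun k => |cov[Y 0, Y k; P]| * comparisonWeight δ u |cov[Y 0, Y k; P]|)
    (fun k => mul_nonneg (abs_nonneg _) (comparisonWeight_nonneg _ _ _)) hs
  rw [Finset.sum_congr rfl fun i _ => Finset.sum_congr rfl fun j _ => by
    rw [hY.covariance_eq_dist hYm i j]]
  refine (mul_le_mul_of_nonneg_left hsum (by positivity)).trans_eq ?_
  have e : ∑ k ∈ Finset.Ico 1 n, |cov[Y 0, Y k; P]| * comparisonWeight δ u |cov[Y 0, Y k; P]| =
      (2 * Real.pi * √(1 - δ ^ 2))⁻¹ * ∑ k ∈ Finset.Ico 1 n, |cov[Y 0, Y k; P]| *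
        Real.exp (-u ^ 2 / (1 + |cov[Y 0, Y k; P]|)) := by
    rw [Finset.mul_sum]
    refine Finset.sum_congr rfl fun k _ => ?_
    rw [comparisonWeight]; ring
  rw [e, mul_inv, mul_inv, mul_inv]
  field_simp

end IsStandardStationaryGaussian

/-! ### Freezing the replacement pattern. -/

theorem partialMax_le_iff {Ω : Type*} {X : ℕ → Ω → ℝ} {n : ℕ} (hn : n ≠ 0) {ω : Ω} {t : ℝ} :
    partialMax X n ω ≤ t ↔ ∀ k ∈ Finset.range n, X k ω ≤ t := by
  have : Nonempty (Fin n) := ⟨⟨0, Nat.pos_of_ne_zero hn⟩⟩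
  rw [partialMax, ciSup_le_iff (Set.finite_range _).bddAbove]
  exact ⟨fun h k hk => h ⟨k, Finset.mem_range.1 hk⟩, fun h k => h k (Finset.mem_range.2 k.2)⟩

/-- Freezing the value of one of two independent random elements. -/
theorem ProbabilityTheory.IndepFun.abs_measureReal_sub_integral_le {Ω 𝓔 𝓩 : Type*}
    [MeasurableSpace Ω] [MeasurableSpace 𝓔] [MeasurableSpace 𝓩] {P : Measure Ω}
    [IsProbabilityMeasure P] {E : Ω → 𝓔} {Z : Ω → 𝓩} (h : IndepFun E Z P) (hE : Measurable E)
    (hZ : Measurable Z) {S : Set (𝓔 × 𝓩)} (hS : MeasurableSet S) {f : 𝓔 → ℝ}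
    (hf : Integrable (fun ω => f (E ω)) P) {B : ℝ}
    (hB : ∀ᵐ ω ∂P, |P.real {ω' | (E ω, Z ω') ∈ S} - f (E ω)| ≤ B) :
    |P.real {ω | (E ω, Z ω) ∈ S} - ∫ ω, f (E ω) ∂P| ≤ B := by
  have hmap := (indepFun_iff_map_prod_eq_prod_map_map hE.aemeasurable hZ.aemeasurable).1 h
  have hsec : Measurable fun e => P {ω' | (e, Z ω') ∈ S} := by
    have h1 : ∀ e, P {ω' | (e, Z ω') ∈ S} = P.map Z (Prod.mk e ⁻¹' S) := fun e => by
      rw [Measure.map_apply hZ (measurable_prodMk_left hS)]; rfl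
    have := Measure.isProbabilityMeasure_map (μ := P) hZ.aemeasurable
    simp only [h1]
    exact measurable_measure_prodMk_left hS
  have e1 : P.real {ω | (E ω, Z ω) ∈ S} = ∫ ω, P.real {ω' | (E ω, Z ω') ∈ S} ∂P := by
    have := Measure.isProbabilityMeasure_map (μ := P) hZ.aemeasurable
    have h2 : P {ω | (E ω, Z ω) ∈ S} = ∫⁻ ω, P {ω' | (E ω, Z ω') ∈ S} ∂P := by
      have h3 : P {ω | (E ω, Z ω) ∈ S} = P.map (fun ω => (E ω, Z ω)) S := by
        rw [Measure.map_apply (hE.prodMk hZ) hS]; rfl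
      rw [h3, hmap, Measure.prod_apply hS, lintegral_map (measurable_measure_prodMk_left hS) hE]
      refine lintegral_congr fun ω => ?_
      rw [Measure.map_apply hZ (measurable_prodMk_left hS)]; rfl
    simp only [measureReal_def]
    rw [h2]
    exact (integral_toReal (hsec.comp hE).aemeasurable
      (Eventually.of_forall fun ω => measure_lt_top _ _)).symm
  have hint : Integrable (fun ω => P.real {ω' | (E ω, Z ω') ∈ S}) P :=
    Integrable.of_bound (C := 1) ((hsec.comp hE).ennreal_toReal.aestronglyMeasurable)
      (Eventually.of_forall fun ω => by
        rw [Real.norm_eq_abs, abs_of_nonneg measureReal_nonneg]; exact measureReal_le_one)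
  rw [e1, ← integral_sub hint hf]
  have := norm_integral_le_of_norm_le_const (μ := P) (C := B) (f := fun ω =>
    P.real {ω' | (E ω, Z ω') ∈ S} - f (E ω)) hB
  simpa using this

/-- Convergence of exponential functionals under convergence in measure. -/
theorem tendsto_integral_exp_mul_one_sub {Ω : Type*} [MeasurableSpace Ω] {P : Measure Ω}
    [IsProbabilityMeasure P] {T : ℕ → Ω → ℝ} {lam : Ω → ℝ} (hT : ∀ n, Measurable (T n))
    (hlim : TendstoInMeasure P T atTop lam) (hT1 : ∀ n, ∀ᵐ ω ∂P, T n ω ≤ 1)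
    {c : ℕ → ℝ} {c₀ : ℝ} (hc : Tendsto c atTop (𝓝 c₀)) (hc0 : ∀ n, c n ≤ 0) :
    Tendsto (fun n => ∫ ω, Real.exp (c n * (1 - T n ω)) ∂P) atTop
      (𝓝 (∫ ω, Real.exp (c₀ * (1 - lam ω)) ∂P)) := by
  -- Convergence in measure gives almost everywhere convergence only along subsequences; this
  -- suffices because the limit is the same for all of them.
  refine tendsto_of_subseq_tendsto fun ns hns => ?_
  have hsub : TendstoInMeasure P (fun k => T (ns k)) atTop lam := fun ε hε =>
    (hlim ε hε).comp hns
  obtain ⟨ms, hms, hae⟩ := hsub.exists_seq_tendsto_ae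
  refine ⟨ms, tendsto_integral_of_dominated_convergence (fun _ => 1) (fun k => ?_)
    (integrable_const 1) (fun k => ?_) ?_⟩
  · exact (((hT _).const_sub 1).const_mul _).exp.aestronglyMeasurable
  · filter_upwards [hT1 (ns (ms k))] with ω hω
    rw [Real.norm_eq_abs, abs_of_pos (Real.exp_pos _)]
    exact Real.exp_le_one_iff.2 (mul_nonpos_of_nonpos_of_nonneg (hc0 _) (by linarith))
  · filter_upwards [hae] with ω hω
    exact (Real.continuous_exp.tendsto _).comp
      ((hc.comp (hns.comp hms.tendsto_atTop)).mul (hω.const_sub 1))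

theorem gumbelLevel_mono (n : ℕ) : Monotone fun x => gumbelLevel x n := fun x y hxy => by
  have : 0 ≤ (gumbelA n)⁻¹ := inv_nonneg.2 (Real.sqrt_nonneg _)
  simp only [gumbelLevel]
  gcongr

theorem measureReal_Iic_gaussianReal_pos (u : ℝ) : 0 < (gaussianReal 0 1).real (Set.Iic u) := by
  have h : gaussianReal 0 1 (Set.Iic u) ≠ 0 := by
    intro h0
    have h1 := gaussianReal_absolutelyContinuous' 0 (v := 1) one_ne_zero h0
    simp at h1
  exact ENNReal.toReal_pos h (measure_ne_top _ _)

theorem abs_mul_sub_mul_le_of_abs_sub_le {a b a' b' B : ℝ} (hb : |b| ≤ 1) (ha' : |a'| ≤ 1)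
    (h1 : |a - a'| ≤ B) (h2 : |b - b'| ≤ B) : |a * b - a' * b'| ≤ 2 * B := by
  have e : a * b - a' * b' = (a - a') * b + a' * (b - b') := by ring
  rw [e, two_mul]
  refine (abs_add_le _ _).trans (add_le_add ?_ ?_)
  · rw [abs_mul]
    exact (mul_le_of_le_one_right (abs_nonneg _) hb).trans h1
  · rw [abs_mul]
    exact (mul_le_of_le_one_left (abs_nonneg _) ha').trans h2

/-- The joint law of the maxima for a deterministic replacement pattern `e`. -/
theorem abs_measureReal_replaced_sub_le {Ω : Type*} [MeasurableSpace Ω] {P : Measure Ω}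
    [IsProbabilityMeasure P] {Y Y' : ℕ → Ω → ℝ}
    (hind : IndepFun (fun ω n => Y n ω) (fun ω n => Y' n ω) P) {n : ℕ} {e : ℕ → ℝ}
    (he : ∀ k, e k = 0 ∨ e k = 1) (u w : ℝ) {B : ℝ}
    (hB : ∀ s ⊆ Finset.range n, ∀ v : ℕ → ℝ, (∀ i, min u w ≤ v i) →
      |P.real {ω | ∀ i ∈ s, Y i ω ≤ v i} -
        ∏ i ∈ s, (gaussianReal 0 1).real (Set.Iic (v i))| ≤ B)
    (hB' : ∀ s ⊆ Finset.range n, ∀ v : ℕ → ℝ, (∀ i, min u w ≤ v i) →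
      |P.real {ω | ∀ i ∈ s, Y' i ω ≤ v i} -
        ∏ i ∈ s, (gaussianReal 0 1).real (Set.Iic (v i))| ≤ B) :
    |P.real {ω | ∀ k ∈ Finset.range n, e k * Y k ω + (1 - e k) * Y' k ω ≤ u ∧ Y k ω ≤ w} -
      Real.exp (n * Real.log ((gaussianReal 0 1).real (Set.Iic (min u w)))) *
        Real.exp (Real.log ((gaussianReal 0 1).real (Set.Iic (max u w))) *
          (n - ∑ k ∈ Finset.range n, e k))| ≤ 2 * B := by
  set Φ : ℝ → ℝ := fun t => (gaussianReal 0 1).real (Set.Iic t) with hΦ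
  have hΦ0 : ∀ t, 0 < Φ t := measureReal_Iic_gaussianReal_pos
  have hΦ1 : ∀ t, Φ t ≤ 1 := fun t => measureReal_le_one
  -- The set s collects the replaced indices. Elsewhere both conditions fall on Y k, whence the
  -- level min u w.
  let s := (Finset.range n).filter fun k => e k = 0
  let v : ℕ → ℝ := fun k => if e k = 0 then w else min u w
  have hset : {ω | ∀ k ∈ Finset.range n, e k * Y k ω + (1 - e k) * Y' k ω ≤ u ∧ Y k ω ≤ w} =
      (fun ω n => Y n ω) ⁻¹' {f | ∀ k ∈ Finset.range n, f k ≤ v k} ∩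
        (fun ω n => Y' n ω) ⁻¹' {f | ∀ k ∈ s, f k ≤ u} := by
    ext ω
    simp only [Set.mem_ofPred_eq, Set.mem_inter_iff, Set.mem_preimage, s, v, Finset.mem_filter]
    constructor
    · intro h
      refine ⟨fun k hk => ?_, fun k hk => ?_⟩
      · have := h k hk
        rcases he k with h0 | h0 <;> simp_all
      · have := h k hk.1
        simp_all
    · rintro ⟨h1, h2⟩ k hk
      have h1k := h1 k hk
      rcases he k with h0 | h0
      · have h2k := h2 k ⟨hk, h0⟩
        simp_all
      · simp_all
  have hmeas : ∀ (t : Finset ℕ) (v : ℕ → ℝ), MeasurableSet {f : ℕ → ℝ | ∀ k ∈ t, f k ≤ v k} := by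
    intro t v
    have : {f : ℕ → ℝ | ∀ k ∈ t, f k ≤ v k} = ⋂ k ∈ t, {f | f k ≤ v k} := by ext f; simp
    rw [this]
    exact t.measurableSet_biInter fun k _ => measurableSet_le (measurable_pi_apply k)
      measurable_const
  have hmul : P.real {ω | ∀ k ∈ Finset.range n, e k * Y k ω + (1 - e k) * Y' k ω ≤ u ∧ Y k ω ≤ w} =
      P.real {ω | ∀ k ∈ Finset.range n, Y k ω ≤ v k} * P.real {ω | ∀ k ∈ s, Y' k ω ≤ u} := by
    rw [hset, measureReal_def, hind.measure_inter_preimage_eq_mul _ _ (hmeas _ v)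
      (hmeas s fun _ => u), ENNReal.toReal_mul]
    rfl
  have hprod : Real.exp (n * Real.log (Φ (min u w))) *
      Real.exp (Real.log (Φ (max u w)) * (n - ∑ k ∈ Finset.range n, e k)) =
      (∏ k ∈ Finset.range n, Φ (v k)) * ∏ k ∈ s, Φ u := by
    have h1 : Real.exp (n * Real.log (Φ (min u w))) = ∏ k ∈ Finset.range n, Φ (min u w) := by
      rw [Real.exp_nat_mul, Real.exp_log (hΦ0 _)]; simp
    have h2 : Real.log (Φ (max u w)) * (n - ∑ k ∈ Finset.range n, e k) =
        ∑ k ∈ Finset.range n, Real.log (Φ (max u w)) * (1 - e k) := by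
      rw [← Finset.mul_sum, Finset.sum_sub_distrib]; simp
    rw [h1, h2, Real.exp_sum, Finset.prod_filter, ← Finset.prod_mul_distrib,
      ← Finset.prod_mul_distrib]
    refine Finset.prod_congr rfl fun k _ => ?_
    -- At a replaced index, Φ u · Φ w = Φ (min u w) · Φ (max u w), so every index contributes Φ (min
    -- u w) and the replaced ones an extra Φ (max u w).
    rcases he k with h0 | h0
    · simp only [v, h0, if_true, sub_zero, mul_one, Real.exp_log (hΦ0 _)]
      rcases le_total u w with h | h
      · rw [min_eq_left h, max_eq_right h, mul_comm]
      · rw [min_eq_right h, max_eq_left h]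
    · simp [v, h0]
  rw [hmul, hprod]
  refine abs_mul_sub_mul_le_of_abs_sub_le ?_ ?_ (hB _ subset_rfl v fun i => ?_)
    (hB' s (Finset.filter_subset _ _) (fun _ => u) fun _ => min_le_left _ _)
  · rw [abs_of_nonneg measureReal_nonneg]; exact measureReal_le_one
  · exact abs_prod_le_one _ fun k => by rw [abs_of_pos (hΦ0 _)]; exact hΦ1 _
  · simp only [v]
    split_ifs
    · exact min_le_right _ _
    · exact le_rfl

/-! ### The joint limit law. -/

theorem theorem2p2 {Ω : Type*} [MeasurableSpace Ω] (P : Measure Ω) [IsProbabilityMeasure P]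
    (Y Y' ε : ℕ → Ω → ℝ) (lam : Ω → ℝ)
    (hYmeas : ∀ n, Measurable (Y n)) (hY'meas : ∀ n, Measurable (Y' n))
    (hεmeas : ∀ n, Measurable (ε n)) (hlammeas : Measurable lam)
    (hY : IsStandardStationaryGaussian P Y)
    (hr : Tendsto (fun n : ℕ => cov[Y 0, Y n; P] * Real.log n) atTop (𝓝 0))
    (hcopy : IsIndependentCopy P Y Y')
    (hε : ∀ n, ∀ᵐ ω ∂P, ε n ω = 0 ∨ ε n ω = 1)
    (hεindep : IndepFun (fun ω (n : ℕ) => ε n ω)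
      (fun ω => ((fun n : ℕ => Y n ω), (fun n : ℕ => Y' n ω))) P)
    (hlam : ∀ᵐ ω ∂P, lam ω ∈ Set.Icc (0 : ℝ) 1)
    (hS : TendstoInMeasure P (fun (n : ℕ) ω => observedCount ε n ω / n) atTop lam)
    (x y : ℝ) :
    Tendsto
      (fun n : ℕ => P.real {ω |
        partialMax (randomReplacing ε Y Y') n ω ≤ (gumbelA n)⁻¹ * x + gumbelB n ∧
        partialMax Y n ω ≤ (gumbelA n)⁻¹ * y + gumbelB n})
      atTop
      (𝓝 (Real.exp (-Real.exp (-min x y)) *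
        ∫ ω, Real.exp (-(1 - lam ω) * Real.exp (-max x y)) ∂P)) := by
  have hr0 := IsStandardStationaryGaussian.tendsto_covariance hr
  obtain ⟨δ, hδ0, hδ1, hδ⟩ := hY.exists_abs_covariance_le hYmeas hr0
  have hY' : IsStandardStationaryGaussian P Y' := hY.of_identDistrib hcopy.identDistrib
  have hcov : ∀ k, cov[Y' 0, Y' k; P] = cov[Y 0, Y k; P] := fun k =>
    covariance_eq_of_identDistrib hY'meas hYmeas hcopy.identDistrib 0 k
  let Φ : ℝ → ℝ := fun t => (gaussianReal 0 1).real (Set.Iic t)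
  -- The comparison error at the lower of the two levels, valid for every pattern and for both
  -- sequences.
  let B : ℕ → ℝ := fun n => (2 * √(1 - δ ^ 2))⁻¹ * (n * ∑ k ∈ Finset.Ico 1 n,
    |cov[Y 0, Y k; P]| * Real.exp (-gumbelLevel (min x y) n ^ 2 / (1 + |cov[Y 0, Y k; P]|)))
  have hBlim : Tendsto B atTop (𝓝 0) := by
    have := tendsto_nat_mul_sum_berman hδ0 hδ1 hδ hr
      (K := 4 * Real.pi * Real.exp (-min x y) ^ 2) (u := gumbelLevel (min x y)) (by positivity)
      (by
        filter_upwards [tendsto_log_natCast.eventually_gt_atTop 0] with n hn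
        exact exp_neg_sq_gumbelLevel_le _ hn)
      (eventually_sq_gumbelLevel_le _)
    have h := this.const_mul (2 * √(1 - δ ^ 2))⁻¹
    rwa [mul_zero] at h
  let c : ℕ → ℝ := fun n => n * Real.log (Φ (gumbelLevel (max x y) n))
  let T : ℕ → Ω → ℝ := fun n ω => observedCount ε n ω / n
  have hεall : ∀ᵐ ω ∂P, ∀ n, ε n ω = 0 ∨ ε n ω = 1 := ae_all_iff.2 hε
  have hcount : ∀ n, Measurable (observedCount ε n) := fun n =>
    Finset.measurable_fun_sum _ fun k _ => hεmeas k
  have hcount_le : ∀ n, ∀ᵐ ω ∂P, observedCount ε n ω ≤ n := by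
    intro n
    filter_upwards [hεall] with ω hω
    have : ∀ k ∈ Finset.range n, ε k ω ≤ 1 := fun k _ => by rcases hω k with h | h <;> simp [h]
    simpa [observedCount] using Finset.sum_le_card_nsmul _ _ _ this
  have hclim : Tendsto c atTop (𝓝 (-Real.exp (-max x y))) :=
    tendsto_nat_mul_log_measureReal_Iic _
  have hlogΦ : ∀ t, Real.log (Φ t) ≤ 0 := fun t =>
    Real.log_nonpos measureReal_nonneg measureReal_le_one
  have hmain : Tendsto (fun n : ℕ => Real.exp (n * Real.log (Φ (gumbelLevel (min x y) n))) *
      ∫ ω, Real.exp (c n * (1 - T n ω)) ∂P) atTop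
      (𝓝 (Real.exp (-Real.exp (-min x y)) *
        ∫ ω, Real.exp (-Real.exp (-max x y) * (1 - lam ω)) ∂P)) := by
    refine ((Real.continuous_exp.tendsto _).comp (tendsto_nat_mul_log_measureReal_Iic _)).mul
      (tendsto_integral_exp_mul_one_sub (fun n => (hcount n).div_const _) hS (fun n => ?_) hclim
        fun n => mul_nonpos_of_nonneg_of_nonpos n.cast_nonneg (hlogΦ _))
    filter_upwards [hcount_le n] with ω hω
    exact div_le_one_of_le₀ hω n.cast_nonneg
  have hlimit : ∀ ω, -(1 - lam ω) * Real.exp (-max x y) = -Real.exp (-max x y) * (1 - lam ω) :=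
    fun ω => by ring
  simp only [hlimit]
  refine tendsto_of_tendsto_of_dist hmain (squeeze_zero' (Eventually.of_forall fun _ =>
    dist_nonneg) ?_ (by simpa using hBlim.const_mul 2))
  filter_upwards [(tendsto_gumbelLevel (min x y)).eventually_ge_atTop 0, eventually_gt_atTop 0]
    with n hu hn
  have hmin : min (gumbelLevel x n) (gumbelLevel y n) = gumbelLevel (min x y) n :=
    ((gumbelLevel_mono n).map_min).symm
  have hmax : max (gumbelLevel x n) (gumbelLevel y n) = gumbelLevel (max x y) n :=
    ((gumbelLevel_mono n).map_max).symm
  let S : Set ((ℕ → ℝ) × ((ℕ → ℝ) × (ℕ → ℝ))) := {p | ∀ k ∈ Finset.range n,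
    p.1 k * p.2.1 k + (1 - p.1 k) * p.2.2 k ≤ gumbelLevel x n ∧ p.2.1 k ≤ gumbelLevel y n}
  have hSm : MeasurableSet S := by
    have : S = ⋂ k ∈ Finset.range n, ({p | p.1 k * p.2.1 k + (1 - p.1 k) * p.2.2 k ≤
        gumbelLevel x n} ∩ {p | p.2.1 k ≤ gumbelLevel y n}) := by
      ext p; simp [S]
    rw [this]
    exact Finset.measurableSet_biInter _ fun k _ =>
      (measurableSet_le (by fun_prop) measurable_const).inter
        (measurableSet_le (by fun_prop) measurable_const)
  have hevent : {ω | partialMax (randomReplacing ε Y Y') n ω ≤ (gumbelA n)⁻¹ * x + gumbelB n ∧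
        partialMax Y n ω ≤ (gumbelA n)⁻¹ * y + gumbelB n} =
      {ω | ((fun n => ε n ω), ((fun n => Y n ω), fun n => Y' n ω)) ∈ S} := by
    ext ω
    simp only [Set.mem_ofPred_eq, S, partialMax_le_iff hn.ne', ← forall₂_and]
    rfl
  let f : (ℕ → ℝ) → ℝ := fun e => Real.exp (n * Real.log (Φ (gumbelLevel (min x y) n))) *
    Real.exp (Real.log (Φ (gumbelLevel (max x y) n)) * (n - ∑ k ∈ Finset.range n, e k))
  have hf : ∀ ω, f (fun n => ε n ω) = Real.exp (n * Real.log (Φ (gumbelLevel (min x y) n))) *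
      Real.exp (c n * (1 - T n ω)) := by
    intro ω
    have hn' : (n : ℝ) ≠ 0 := by exact_mod_cast hn.ne'
    simp only [f, c, T, observedCount]
    congr 2
    field_simp
  have hfint : Integrable (fun ω => f fun n => ε n ω) P := by
    simp only [hf]
    refine Integrable.const_mul (Integrable.of_bound (C := 1)
      ((((hcount n).div_const _).const_sub 1).const_mul _).exp.aestronglyMeasurable ?_) _
    filter_upwards [hcount_le n] with ω hω
    rw [Real.norm_eq_abs, abs_of_pos (Real.exp_pos _)]
    refine Real.exp_le_one_iff.2 (mul_nonpos_of_nonpos_of_nonneg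
      (mul_nonpos_of_nonneg_of_nonpos n.cast_nonneg (hlogΦ _)) ?_)
    exact sub_nonneg.2 (div_le_one_of_le₀ hω n.cast_nonneg)
  -- The error 2 * B n holds for almost every frozen pattern, one B n for each sequence, and so
  -- survives averaging over ε.
  have key := hεindep.abs_measureReal_sub_integral_le (measurable_pi_lambda _ hεmeas)
    ((measurable_pi_lambda _ hYmeas).prodMk (measurable_pi_lambda _ hY'meas)) hSm hfint
    (B := 2 * B n) (by
      filter_upwards [hεall] with ω hω
      have h := abs_measureReal_replaced_sub_le hcopy.indep (n := n)
        (e := fun k => ε k ω) hω (gumbelLevel x n) (gumbelLevel y n) (B := B n)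
        (fun s hs v hv => hY.abs_measureReal_sub_prod_le hYmeas hδ1 hδ hu hs
          fun i => hmin ▸ hv i)
        (fun s hs v hv => by
          have h := hY'.abs_measureReal_sub_prod_le hY'meas hδ1
            (fun k hk => by rw [hcov]; exact hδ k hk) hu hs fun i => hmin ▸ hv i
          simpa only [hcov] using h)
      rw [hmin, hmax] at h
      exact h)
  rw [hevent, dist_comm, Real.dist_eq, ← integral_const_mul]
  simp only [hf] at key
  exact key
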